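/- Let $V\in L^\infty(0,2\pi)$ be complex-valued with $\operatorname{Im}V\ge 0$ almost everywhere and $\operatorname{Im}V>0$ on a set of positive Lebesgue measure. Let $k\in L^2(0,2\pi)$ and $\rho\in\mathbb C\setminus\{0\}$, and let $A_{\rho,k}$ be the operator in $L^2(0,2\pi)$ given by $$\operatorname{dom}(A_{\rho,k})=\{f\in H^1(0,2\pi): f(0)=\rho f(2\pi)\},\qquad A_{\rho,k}f=if'+Vf+f(2\pi)k .$$ Assume that $A_{\rho,k}$ is maximally dissipative, i.e. it is densely defined, $\operatorname{Im}\langle f,A_{\rho,k}f\rangle\ge 0$ for all $f\in\operatorname{dom}(A_{\rho,k})$ (the inner product being linear in the second argument), and it has no proper extension with these two properties. Then: 1. $\sigma(A_{\rho,k})\setminus\mathbb R$ is non-empty and $$\inf_{\mu\in\sigma(A_{\rho,k})\setminus\mathbb R}\operatorname{Im}\mu>0 .$$ 2. The root functions of $A_{\rho,k}$ form a Riesz basis of $L^2(0,2\pi)$. That is, for $\lambda\in\mathbb C$ let $\mathcal R(\lambda,A_{\rho,k})=\{f:\ (A_{\rho,k}-\lambda)^jf=0\text{ for some }j\in\mathbb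 N\}$. There is a system $(f_n)_{n\in\mathbb Z}$ of unit vectors made up of bases of all the root spaces $\mathcal R(\lambda,A_{\rho,k})$, and every system $(f_n)_{n\in\mathbb Z}$ made up of bases of all the root spaces with $0<\inf_n\|f_n\|\le\sup_n\|f_n\|<\infty$ is a Riesz basis: there are a bounded and boundedly invertible operator $S$ on $L^2(0,2\pi)$ and an orthonormal basis $(\psi_n)_{n\in\mathbb Z}$ of $L^2(0,2\pi)$ with $f_n=S\psi_n$ for all $n\in\mathbb Z$. -/

import Mathlib

open MeasureTheory Set
open scoped ENNReal Interval

noncomputable section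

namespace NonlocalPoint

/-- Lebesgue measure on the interval `(0, 2π)`. -/
abbrev mu : Measure ℝ := volume.restrict (Ioo 0 (2 * Real.pi))

/-- The Hilbert space `L²(0, 2π)`. -/
abbrev H : Type := Lp ℂ 2 mu

/-- The space `L^∞(0, 2π)`. -/
abbrev LInfty : Type := Lp ℂ ∞ mu

/-! ### The Sobolev space `H¹(0, 2π)` -/

/-- `F` is the absolutely continuous representative on `[0, 2π]` of the class `f ∈ L²(0, 2π)`,
and `g ∈ L²(0, 2π)` is its derivative. -/
structure IsACRep (f : H) (F : ℝ → ℂ) (g : H) : Prop where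
  ae_eq : f =ᵐ[mu] F
  eq_integral : ∀ x ∈ Icc 0 (2 * Real.pi), F x = F 0 + ∫ t in (0 : ℝ)..x, g t

theorem two_pi_pos : 0 < 2 * Real.pi := by positivity

theorem intervalIntegrable_coe (g : H) {x : ℝ} (hx : x ∈ Icc 0 (2 * Real.pi)) :
    IntervalIntegrable g volume 0 x := by
  have h1 : Integrable g mu := (Lp.memLp g).integrable (by norm_num)
  have h2 : IntegrableOn g (Ioc 0 (2 * Real.pi)) volume :=
    (integrableOn_Ioc_iff_integrableOn_Ioo).2 h1
  exact (intervalIntegrable_iff_integrableOn_Ioc_of_le hx.1).2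
    (h2.mono_set (Ioc_subset_Ioc_right hx.2))

theorem integral_congr_coe {u v : ℝ → ℂ} (h : u =ᵐ[mu] v) {x : ℝ}
    (hx : x ∈ Icc 0 (2 * Real.pi)) :
    ∫ t in (0 : ℝ)..x, u t = ∫ t in (0 : ℝ)..x, v t := by
  rw [intervalIntegral.integral_of_le hx.1, intervalIntegral.integral_of_le hx.1,
    integral_Ioc_eq_integral_Ioo, integral_Ioc_eq_integral_Ioo]
  exact integral_congr_ae (ae_restrict_of_ae_restrict_of_subset (Ioo_subset_Ioo_right hx.2) h)

theorem IsACRep.add {f₁ f₂ g₁ g₂ : H} {F₁ F₂ : ℝ → ℂ} (h₁ : IsACRep f₁ F₁ g₁)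
    (h₂ : IsACRep f₂ F₂ g₂) : IsACRep (f₁ + f₂) (F₁ + F₂) (g₁ + g₂) where
  ae_eq := (Lp.coeFn_add f₁ f₂).trans (h₁.ae_eq.add h₂.ae_eq)
  eq_integral x hx := by
    rw [integral_congr_coe (Lp.coeFn_add g₁ g₂) hx]
    simp only [Pi.add_apply]
    rw [intervalIntegral.integral_add (intervalIntegrable_coe g₁ hx) (intervalIntegrable_coe g₂ hx),
      h₁.eq_integral x hx, h₂.eq_integral x hx]
    ring

theorem IsACRep.smul {f g : H} {F : ℝ → ℂ} (c : ℂ) (h : IsACRep f F g) :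
    IsACRep (c • f) (c • F) (c • g) where
  ae_eq := (Lp.coeFn_smul c f).trans (h.ae_eq.const_smul c)
  eq_integral x hx := by
    rw [integral_congr_coe (Lp.coeFn_smul c g) hx]
    simp only [Pi.smul_apply]
    rw [intervalIntegral.integral_smul, h.eq_integral x hx, smul_add]

theorem IsACRep.zero : IsACRep 0 0 0 where
  ae_eq := Lp.coeFn_zero ℂ 2 mu
  eq_integral x hx := by
    rw [integral_congr_coe (Lp.coeFn_zero ℂ 2 mu) hx]
    simp

theorem IsACRep.continuousOn {f g : H} {F : ℝ → ℂ} (h : IsACRep f F g) :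
    ContinuousOn F (Icc 0 (2 * Real.pi)) := by
  have h1 : IntegrableOn g (Icc 0 (2 * Real.pi)) volume := by
    rw [integrableOn_Icc_iff_integrableOn_Ioc]
    exact (intervalIntegrable_iff_integrableOn_Ioc_of_le two_pi_pos.le).1
      (intervalIntegrable_coe g (right_mem_Icc.2 two_pi_pos.le))
  have h2 : ContinuousOn (fun x => F 0 + ∫ t in (0 : ℝ)..x, g t) (Icc 0 (2 * Real.pi)) := by
    refine continuousOn_const.add ?_
    have := intervalIntegral.continuousOn_primitive_interval (a := (0 : ℝ)) (b := 2 * Real.pi)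
      (f := g) (μ := volume) (by rwa [uIcc_of_le two_pi_pos.le])
    rwa [uIcc_of_le two_pi_pos.le] at this
  exact h2.congr fun x hx => h.eq_integral x hx

/-- The absolutely continuous representative is unique on `[0, 2π]`. -/
theorem IsACRep.eqOn {f g₁ g₂ : H} {F₁ F₂ : ℝ → ℂ} (h₁ : IsACRep f F₁ g₁)
    (h₂ : IsACRep f F₂ g₂) : EqOn F₁ F₂ (Icc 0 (2 * Real.pi)) := by
  refine Measure.eqOn_Icc_of_ae_eq (μ := volume) two_pi_pos.ne ?_ h₁.continuousOn h₂.continuousOn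
  rw [← restrict_Ioo_eq_restrict_Icc]
  exact h₁.ae_eq.symm.trans h₂.ae_eq

/-- The derivative is unique. -/
theorem IsACRep.deriv_unique {f g₁ g₂ : H} {F₁ F₂ : ℝ → ℂ} (h₁ : IsACRep f F₁ g₁)
    (h₂ : IsACRep f F₂ g₂) : g₁ = g₂ := by
  have hF := h₁.eqOn h₂
  have h0 : F₁ 0 = F₂ 0 := hF (left_mem_Icc.2 two_pi_pos.le)
  have hI : ∀ x ∈ Icc 0 (2 * Real.pi),
      ∫ t in (0 : ℝ)..x, g₁ t = ∫ t in (0 : ℝ)..x, g₂ t := by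
    intro x hx
    have := hF hx
    rw [h₁.eq_integral x hx, h₂.eq_integral x hx, h0] at this
    exact add_left_cancel this
  have hmem : 2 * Real.pi ∈ Icc 0 (2 * Real.pi) := right_mem_Icc.2 two_pi_pos.le
  apply Lp.ext
  rw [Filter.EventuallyEq, ae_restrict_iff' measurableSet_Ioo]
  filter_upwards [(intervalIntegrable_coe g₁ hmem).ae_hasDerivAt_integral,
    (intervalIntegrable_coe g₂ hmem).ae_hasDerivAt_integral] with x d₁ d₂ hx
  have hxu : x ∈ uIcc 0 (2 * Real.pi) := by
    rw [uIcc_of_le two_pi_pos.le]; exact Ioo_subset_Icc_self hx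
  have e₁ := d₁ hxu 0 left_mem_uIcc
  have e₂ := d₂ hxu 0 left_mem_uIcc
  refine e₁.unique (e₂.congr_of_eventuallyEq ?_)
  filter_upwards [isOpen_Ioo.mem_nhds hx] with y hy
  exact hI y (Ioo_subset_Icc_self hy)

/-- The Sobolev space `H¹(0, 2π)`: the classes in `L²(0, 2π)` with an absolutely continuous
representative on `[0, 2π]` whose derivative is in `L²(0, 2π)`. -/
def H1 : Submodule ℂ H where
  carrier := {f | ∃ F g, IsACRep f F g}
  add_mem' := by
    rintro f₁ f₂ ⟨F₁, g₁, h₁⟩ ⟨F₂, g₂, h₂⟩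
    exact ⟨_, _, h₁.add h₂⟩
  zero_mem' := ⟨_, _, IsACRep.zero⟩
  smul_mem' := by
    rintro c f ⟨F, g, h⟩
    exact ⟨_, _, h.smul c⟩

/-- The absolutely continuous representative of `f ∈ H¹(0, 2π)`; its values on `[0, 2π]` are
uniquely determined, and only those are used. -/
def acRep (f : H1) : ℝ → ℂ := f.2.choose

/-- The derivative `f' ∈ L²(0, 2π)` of `f ∈ H¹(0, 2π)`, as a function. -/
def derivFun (f : H1) : H := f.2.choose_spec.choose

theorem isACRep (f : H1) : IsACRep f (acRep f) (derivFun f) :=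
  f.2.choose_spec.choose_spec

/-- The point evaluation `f ↦ f(x)` on `H¹(0, 2π)`, for `x ∈ [0, 2π]`. -/
def evalAt (x : Icc 0 (2 * Real.pi)) : H1 →ₗ[ℂ] ℂ where
  toFun f := acRep f x
  map_add' f₁ f₂ := (isACRep (f₁ + f₂)).eqOn ((isACRep f₁).add (isACRep f₂)) x.2
  map_smul' c f := (isACRep (c • f)).eqOn ((isACRep f).smul c) x.2

/-- The derivative `H¹(0, 2π) → L²(0, 2π)`, `f ↦ f'`. -/
def derivL : H1 →ₗ[ℂ] H where
  toFun := derivFun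
  map_add' f₁ f₂ := (isACRep (f₁ + f₂)).deriv_unique ((isACRep f₁).add (isACRep f₂))
  map_smul' c f := (isACRep (c • f)).deriv_unique ((isACRep f).smul c)

/-- `f(0)` for `f ∈ H¹(0, 2π)`. -/
def evalLeft : H1 →ₗ[ℂ] ℂ := evalAt ⟨0, left_mem_Icc.2 two_pi_pos.le⟩

/-- `f(2π)` for `f ∈ H¹(0, 2π)`. -/
def evalRight : H1 →ₗ[ℂ] ℂ := evalAt ⟨2 * Real.pi, right_mem_Icc.2 two_pi_pos.le⟩

/-! ### The operator with a non-local point interaction -/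

/-- Multiplication by `V ∈ L^∞(0, 2π)` on `L²(0, 2π)`. -/
def mulOp (V : LInfty) : H →ₗ[ℂ] H where
  toFun f := (V • f : H)
  map_add' f₁ f₂ := Lp.add_smul V f₁ f₂
  map_smul' c f := (Lp.smul_comm c V f).symm

/-- The expression `f ↦ i f' + V f + f(2π) k` on `H¹(0, 2π)`. -/
def action (V : LInfty) (k : H) : H1 →ₗ[ℂ] H :=
  Complex.I • derivL + (mulOp V).comp H1.subtype + evalRight.smulRight k

/-- The subspace `{f ∈ H¹(0, 2π) | f(0) = ρ f(2π)}` of `H¹(0, 2π)`. -/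
def bcSubspace (ρ : ℂ) : Submodule ℂ H1 := LinearMap.ker (evalLeft - ρ • evalRight)

/-- The operator `A_{ρ,k}`, with `dom A_{ρ,k} = {f ∈ H¹(0, 2π) | f(0) = ρ f(2π)}` and
`A_{ρ,k} f = i f' + V f + f(2π) k`. -/
def opA (V : LInfty) (ρ : ℂ) (k : H) : H →ₗ.[ℂ] H where
  domain := (bcSubspace ρ).map H1.subtype
  toFun := (action V k).comp (Submodule.inclusion (Submodule.map_subtype_le H1 (bcSubspace ρ)))

/-! ### Unbounded operators: dissipativity, spectrum, root spaces, Riesz bases -/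

section General

variable {E : Type*} [NormedAddCommGroup E] [InnerProductSpace ℂ E]

/-- `A` is densely defined and `Im ⟨f, A f⟩ ≥ 0` for all `f ∈ dom A`; the inner product is
antilinear in the first and linear in the second variable. -/
def IsDissipative (A : E →ₗ.[ℂ] E) : Prop :=
  Dense (A.domain : Set E) ∧ ∀ f : A.domain, 0 ≤ (inner ℂ (f : E) (A f)).im

/-- `A` is dissipative and has no proper dissipative operator extension. -/
def IsMaxDissipative (A : E →ₗ.[ℂ] E) : Prop :=
  IsDissipative A ∧ ∀ B : E →ₗ.[ℂ] E, IsDissipative B → A ≤ B → B = A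

/-- `R` is the bounded inverse of `A - z : dom A → E`, that is `R = (A - z)⁻¹`. -/
def IsResolventAt (A : E →ₗ.[ℂ] E) (z : ℂ) (R : E →L[ℂ] E) : Prop :=
  (∀ g : E, ∃ h : R g ∈ A.domain, A ⟨R g, h⟩ - z • R g = g) ∧
    ∀ f : A.domain, R (A f - z • (f : E)) = f

/-- The resolvent set `ϱ(A)`. -/
def resolventSetOf (A : E →ₗ.[ℂ] E) : Set ℂ := {z | ∃ R : E →L[ℂ] E, IsResolventAt A z R}

/-- The spectrum `σ(A)`. -/
def spectrumOf (A : E →ₗ.[ℂ] E) : Set ℂ := (resolventSetOf A)ᶜ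

/-- The kernel of `(A - z)^n`, on its natural domain:
`f ∈ ker (A - z)^(n+1)` iff `f ∈ dom A` and `(A - z) f ∈ ker (A - z)^n`. -/
def kerPow (A : E →ₗ.[ℂ] E) (z : ℂ) : ℕ → Submodule ℂ E
  | 0 => ⊥
  | n + 1 => ((kerPow A z n).comap (A.toFun - z • A.domain.subtype)).map A.domain.subtype

theorem mem_kerPow_succ (A : E →ₗ.[ℂ] E) (z : ℂ) (n : ℕ) (f : E) :
    f ∈ kerPow A z (n + 1) ↔ ∃ h : f ∈ A.domain, A ⟨f, h⟩ - z • f ∈ kerPow A z n := by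
  simp only [kerPow, Submodule.mem_map, Submodule.mem_comap]
  constructor
  · rintro ⟨y, hy, rfl⟩
    exact ⟨y.2, hy⟩
  · rintro ⟨h, hf⟩
    exact ⟨⟨f, h⟩, hf, rfl⟩

theorem kerPow_mono (A : E →ₗ.[ℂ] E) (z : ℂ) : Monotone (kerPow A z) := by
  refine monotone_nat_of_le_succ fun n => ?_
  induction n with
  | zero => exact bot_le
  | succ n ih => exact Submodule.map_mono (Submodule.comap_mono ih)

/-- The root space `R(z, A)` of all `f` with `(A - z)^n f = 0` for some `n`. -/
def rootSpace (A : E →ₗ.[ℂ] E) (z : ℂ) : Submodule ℂ E where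
  carrier := {f | ∃ n, f ∈ kerPow A z n}
  add_mem' := by
    rintro a b ⟨m, hm⟩ ⟨n, hn⟩
    exact ⟨max m n, (kerPow A z _).add_mem (kerPow_mono A z (le_max_left m n) hm)
      (kerPow_mono A z (le_max_right m n) hn)⟩
  zero_mem' := ⟨0, Submodule.zero_mem _⟩
  smul_mem' := by
    rintro c a ⟨n, hn⟩
    exact ⟨n, (kerPow A z n).smul_mem c hn⟩

/-- The family `f` is made up of bases of all the root spaces of `A`: each index `n` is assigned
to a number `l n`, and for every `z` the `f n` with `l n = z` are a basis of the root space of `A`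
at `z`. (The root space is `{0}`, with empty basis, unless `z` is an eigenvalue.) -/
def IsRootSystem (A : E →ₗ.[ℂ] E) (f : ℤ → E) : Prop :=
  ∃ l : ℤ → ℂ, ∀ z : ℂ,
    LinearIndependent ℂ (fun n : {n : ℤ // l n = z} => f n) ∧
      Submodule.span ℂ (f '' {n | l n = z}) = rootSpace A z

/-- A Riesz basis: the image of an orthonormal basis under a bounded and boundedly invertible
operator. -/
def IsRieszBasis (f : ℤ → E) : Prop :=
  ∃ (S : E ≃L[ℂ] E) (b : HilbertBasis ℤ ℂ E), ∀ n, f n = S (b n)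

end General

end NonlocalPoint

end

noncomputable section

namespace NonlocalPoint

open Filter Topology

set_option linter.unusedSectionVars false

/-! ### Bessel families and Riesz coordinates -/

section Bessel

variable {ι E F G : Type*} [NormedAddCommGroup E] [InnerProductSpace ℂ E] [CompleteSpace E]
  [NormedAddCommGroup F] [NormedSpace ℂ F] [CompleteSpace F]
  [NormedAddCommGroup G] [NormedSpace ℂ G]

/-! Asymptotics. Treating `f(2π)` as a known scalar turns `A f = z f` into a linear first order
equation. With `f(2π) = 1`, variation of constants gives the explicit candidate `eigFun`, and `z` is
an eigenvalue when this candidate does take the value `1` at `2π`. Choose `c` with `e^{2πic} = ρ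
e^{i∫V}` and put `m(x) = exp(i∫₀ˣV - icx)`. Dividing by `ρ m` removes the potential, replaces `k` by
`q = k/(ρm)`, and with `z = c + n + ε` leaves the condition `e^{2πiε} - 1 = i∫ e^{int} e^{iεt} q(t)
dt`. For large `|n|` a contraction argument (`exists_shifts`) gives a solution `ε n` dominated by
the `n`-th Fourier coefficient of `q`, so the shifts are square summable. By Bessel's inequality,
uniform in the upper limit of integration, the gauged eigenfunctions are quadratically close to the
Fourier basis (`summable_modelH_sub`, `exists_eigensystem`).

Position of the spectrum. Dissipativity, tested on functions concentrated at the endpoints, forces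
`|ρ| ≤ 1`. Hence `|ρ e^{i∫V}| = |ρ| e^{-∫ Im V} < 1` and `Im c > 0`: the eigenvalues `n + c + ε n`
approach a line strictly above the real axis. The open lower half plane lies in the resolvent set,
so non-real spectrum has positive imaginary part. Once all but finitely many spectral points are
known to be of the form `n + c + ε n`, only finitely many lie below height `Im c / 2`, and the
infimum is positive.

Completeness. Outside a finite set `F` the eigenvectors are `T (b n)` for an orthonormal basis `b`
and an isomorphism `T`, by a Neumann series. Let `R` be a resolvent of `A`. The closed span `M` of
these vectors is invariant under `R` and has finite codimension, so the map induced by `R` on the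
quotient has a minimal polynomial. Its factor `X^j` can be cancelled because `R` has dense range and
`M` is closed, which leaves a polynomial `p` with `p(0) ≠ 0` and `p(R)E ⊆ M`. After enlarging `F`, a
polynomial `q` (unrelated to the function above) gives the algebraic splitting `E = M ⊕ ker q(R)`,
with a finite-dimensional kernel spanned by root vectors; this is `TailSplit`. It controls the
spectrum outside the known eigenvalues and shows that a root system consists of multiples of the `T
(b n)`, `n ∉ F`, together with a basis of `ker q(R)`. No count of the exceptional root vectors is
required (`TailSplit.isRieszBasis_of_isRootSystem`). -/

/-- `w` satisfies the Bessel-type bound `‖∑ x i • w i‖ ≤ C ‖x‖` with constant `C`. -/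
def IsBessel (C : ℝ) (w : ι → F) : Prop :=
  0 ≤ C ∧ ∀ (s : Finset ι) (x : ι → ℂ), ‖∑ i ∈ s, x i • w i‖ ^ 2 ≤ C ^ 2 * ∑ i ∈ s, ‖x i‖ ^ 2

theorem summable_norm_sq_repr (b : HilbertBasis ι ℂ E) (x : E) :
    Summable fun i => ‖b.repr x i‖ ^ 2 := by
  have := (b.repr x).2
  have h := (memℓp_gen_iff (p := 2) (by norm_num)).1 this
  simpa using h

theorem tsum_norm_sq_repr (b : HilbertBasis ι ℂ E) (x : E) :
    ∑' i, ‖b.repr x i‖ ^ 2 = ‖x‖ ^ 2 := by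
  have h := lp.norm_rpow_eq_tsum (p := 2) (by norm_num) (b.repr x)
  rw [b.repr.norm_map] at h
  have h2 : ‖x‖ ^ (2 : ℕ) = ∑' i, ‖b.repr x i‖ ^ (2 : ℕ) := by
    simpa using h
  exact h2.symm

theorem IsBessel.summable {C : ℝ} {w : ι → F} (hw : IsBessel C w) (b : HilbertBasis ι ℂ E) (x : E) :
    Summable fun i => b.repr x i • w i := by
  rw [summable_iff_vanishing_norm]
  intro ε hε
  -- Dividing by `C + 1` instead of `C` also covers `C = 0` and makes the final inequality strict.
  obtain ⟨s, hs⟩ := summable_iff_vanishing_norm.1 (summable_norm_sq_repr b x)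
    ((ε / (C + 1)) ^ 2) (by have := hw.1; positivity)
  refine ⟨s, fun t ht => ?_⟩
  have h1 := hs t ht
  rw [Real.norm_of_nonneg (Finset.sum_nonneg fun i _ => by positivity)] at h1
  have h2 := hw.2 t (fun i => b.repr x i)
  have hC := hw.1
  refine lt_of_pow_lt_pow_left₀ 2 hε.le (h2.trans_lt ?_)
  calc C ^ 2 * ∑ i ∈ t, ‖b.repr x i‖ ^ 2 ≤ C ^ 2 * (ε / (C + 1)) ^ 2 := by gcongr
    _ < (C + 1) ^ 2 * (ε / (C + 1)) ^ 2 := by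
        have : 0 < (ε / (C + 1)) ^ 2 := by positivity
        have : C ^ 2 < (C + 1) ^ 2 := by nlinarith
        gcongr
    _ = ε ^ 2 := by field_simp

/-- A Bessel family is the image of an orthonormal basis under a bounded operator. -/
theorem IsBessel.exists_operator {C : ℝ} {w : ι → F} (hw : IsBessel C w)
    (b : HilbertBasis ι ℂ E) :
    ∃ S : E →L[ℂ] F, (∀ i, S (b i) = w i) ∧ ‖S‖ ≤ C := by
  classical
  let S₀ : E →ₗ[ℂ] F :=
    { toFun := fun x => ∑' i, b.repr x i • w i
      map_add' := fun x y => by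
        rw [← (hw.summable b x).tsum_add (hw.summable b y)]
        simp [add_smul]
      map_smul' := fun c x => by
        simp only [map_smul, lp.coeFn_smul, Pi.smul_apply, RingHom.id_apply, smul_assoc]
        exact (hw.summable b x).tsum_const_smul c }
  have hb : ∀ x, ‖S₀ x‖ ≤ C * ‖x‖ := by
    intro x
    refine le_of_tendsto ((hw.summable b x).hasSum.norm) (Eventually.of_forall fun s => ?_)
    refine le_of_sq_le_sq ?_ (mul_nonneg hw.1 (norm_nonneg _))
    refine (hw.2 s _).trans ?_
    rw [mul_pow, ← tsum_norm_sq_repr b x]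
    gcongr
    exact (summable_norm_sq_repr b x).sum_le_tsum s (fun i _ => by positivity)
  refine ⟨S₀.mkContinuous C hb, fun i => ?_, LinearMap.mkContinuous_norm_le _ hw.1 _⟩
  change ∑' j, b.repr (b i) j • w j = w i
  rw [tsum_eq_single i]
  · simp [b.repr_self]
  · intro j hj
    simp [b.repr_self, hj]

theorem IsBessel.of_norm_sq_summable {w : ι → F} (hw : Summable fun i => ‖w i‖ ^ 2) :
    IsBessel (√(∑' i, ‖w i‖ ^ 2)) w := by
  refine ⟨Real.sqrt_nonneg _, fun s x => ?_⟩
  rw [Real.sq_sqrt (tsum_nonneg fun i => by positivity)]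
  have h1 : ‖∑ i ∈ s, x i • w i‖ ≤ ∑ i ∈ s, ‖x i‖ * ‖w i‖ :=
    (norm_sum_le _ _).trans_eq (by simp [norm_smul])
  calc ‖∑ i ∈ s, x i • w i‖ ^ 2 ≤ (∑ i ∈ s, ‖x i‖ * ‖w i‖) ^ 2 := by gcongr
    _ ≤ (∑ i ∈ s, ‖x i‖ ^ 2) * ∑ i ∈ s, ‖w i‖ ^ 2 := Finset.sum_mul_sq_le_sq_mul_sq _ _ _
    _ ≤ (∑ i ∈ s, ‖x i‖ ^ 2) * ∑' i, ‖w i‖ ^ 2 := by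
        gcongr
        exact hw.sum_le_tsum s (fun i _ => by positivity)
    _ = _ := mul_comm _ _

/-- Injectivity of `σ` on `J` keeps the non-zero members orthogonal, so Pythagoras gives the bound.
It is used to build diagonal operators and operators that relabel basis vectors. -/
theorem IsBessel.of_orthonormal_comp (b : HilbertBasis ι ℂ E) {κ : Type*} (J : Set κ) (σ : κ → ι)
    (hσ : InjOn σ J) (a : κ → ℂ) {C : ℝ} (hC : 0 ≤ C) (ha : ∀ k, k ∈ J → ‖a k‖ ≤ C) :
    IsBessel C (J.indicator fun k => a k • b (σ k)) := by
  classical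
  refine ⟨hC, fun s x => ?_⟩
  have h1 : ∑ i ∈ s, x i • J.indicator (fun k => a k • b (σ k)) i =
      ∑ i ∈ s with i ∈ J, (x i * a i) • b (σ i) := by
    rw [Finset.sum_filter]
    refine Finset.sum_congr rfl fun i _ => ?_
    by_cases hi : i ∈ J <;> simp [hi, mul_smul]
  have ho : ∀ i ∈ s.filter (· ∈ J), ∀ j ∈ s.filter (· ∈ J),
      i ≠ j → inner ℂ ((x i * a i) • b (σ i)) ((x j * a j) • b (σ j)) = 0 := by
    intro i hi j hj hij
    rw [inner_smul_left, inner_smul_right, b.orthonormal.2, mul_zero, mul_zero]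
    exact fun h => hij (hσ (Finset.mem_filter.1 hi).2 (Finset.mem_filter.1 hj).2 h)
  have h2 : ‖∑ i ∈ s with i ∈ J, (x i * a i) • b (σ i)‖ ^ 2 =
      ∑ i ∈ s with i ∈ J, ‖(x i * a i) • b (σ i)‖ ^ 2 := by
    have : ∀ t : Finset κ, t ⊆ s.filter (· ∈ J) → ‖∑ i ∈ t, (x i * a i) • b (σ i)‖ ^ 2 =
      ∑ i ∈ t, ‖(x i * a i) • b (σ i)‖ ^ 2 := by
      intro t
      induction t using Finset.induction_on with
      | empty => simp
      | insert i t hit ih =>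
        intro ht
        rw [Finset.sum_insert hit, Finset.sum_insert hit,
          ← ih ((Finset.subset_insert i t).trans ht), sq, sq, sq]
        refine (norm_add_sq_eq_norm_sq_add_norm_sq_of_inner_eq_zero (𝕜 := ℂ) _ _ ?_).trans ?_
        · rw [inner_sum]
          refine Finset.sum_eq_zero fun j hj => ho i (ht (Finset.mem_insert_self _ _)) j
            (ht (Finset.mem_insert_of_mem hj)) ?_
          rintro rfl; exact hit hj
        · rfl
    exact this _ subset_rfl
  rw [h1, h2, Finset.mul_sum]
  calc ∑ i ∈ s with i ∈ J, ‖(x i * a i) • b (σ i)‖ ^ 2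
      ≤ ∑ i ∈ s with i ∈ J, C ^ 2 * ‖x i‖ ^ 2 := by
        refine Finset.sum_le_sum fun i hi => ?_
        rw [norm_smul, b.orthonormal.1, mul_one, norm_mul, mul_pow, mul_comm]
        have := ha i (Finset.mem_filter.1 hi).2
        gcongr
    _ ≤ ∑ i ∈ s, C ^ 2 * ‖x i‖ ^ 2 :=
        Finset.sum_le_sum_of_subset_of_nonneg (Finset.filter_subset _ _)
          (fun i _ _ => by positivity)

/-- Two bounded operators which agree on a Hilbert basis are equal. -/
theorem ext_hilbertBasis (b : HilbertBasis ι ℂ E) {S S' : E →L[ℂ] F}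
    (h : ∀ i, S (b i) = S' (b i)) : S = S' := by
  refine ContinuousLinearMap.ext_on (s := range b) ?_ ?_
  · have := b.dense_span
    rw [dense_iff_closure_eq, ← Submodule.topologicalClosure_coe, this]; rfl
  · rintro _ ⟨i, rfl⟩; exact h i

end Bessel

/-! ### Coordinates of a Riesz basis and its closed tails of finite codimension -/

section Tail

variable {ι E : Type*} [NormedAddCommGroup E] [InnerProductSpace ℂ E] [CompleteSpace E]

/-- The `n`-th coordinate functional of the Riesz basis `T (b n)`. -/
def coord (b : HilbertBasis ι ℂ E) (T : E ≃L[ℂ] E) (n : ι) : E →L[ℂ] ℂ :=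
  (innerSL ℂ (b n)).comp (T.symm : E →L[ℂ] E)

theorem coord_apply (b : HilbertBasis ι ℂ E) (T : E ≃L[ℂ] E) (n : ι) (x : E) :
    coord b T n x = b.repr (T.symm x) n := by
  simp [coord, b.repr_apply_apply]

theorem coord_basis [DecidableEq ι] (b : HilbertBasis ι ℂ E) (T : E ≃L[ℂ] E) (n m : ι) :
    coord b T n (T (b m)) = if n = m then 1 else 0 := by
  rw [coord_apply, T.symm_apply_apply, b.repr_self, lp.single_apply, Pi.single_apply]

theorem hasSum_coord (b : HilbertBasis ι ℂ E) (T : E ≃L[ℂ] E) (x : E) :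
    HasSum (fun n => coord b T n x • T (b n)) x := by
  have h := (b.hasSum_repr (T.symm x)).mapL (T : E →L[ℂ] E)
  simpa [coord_apply] using h

theorem coord_ext (b : HilbertBasis ι ℂ E) (T : E ≃L[ℂ] E) {x y : E}
    (h : ∀ n, coord b T n x = coord b T n y) : x = y := by
  refine (hasSum_coord b T x).unique ?_
  simp_rw [h]
  exact hasSum_coord b T y

/-- The closed span of the vectors `T (b n)` with `n ∉ F`. -/
def tailSub (b : HilbertBasis ι ℂ E) (T : E ≃L[ℂ] E) (F : Finset ι) : Submodule ℂ E where
  carrier := {x | ∀ n ∈ F, coord b T n x = 0}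
  add_mem' hx hy n hn := by rw [map_add, hx n hn, hy n hn, add_zero]
  zero_mem' n _ := map_zero _
  smul_mem' c x hx n hn := by rw [map_smul, hx n hn, smul_zero]

theorem mem_tailSub {b : HilbertBasis ι ℂ E} {T : E ≃L[ℂ] E} {F : Finset ι} {x : E} :
    x ∈ tailSub b T F ↔ ∀ n ∈ F, coord b T n x = 0 := Iff.rfl

theorem isClosed_tailSub (b : HilbertBasis ι ℂ E) (T : E ≃L[ℂ] E) (F : Finset ι) :
    IsClosed (tailSub b T F : Set E) := by
  have : (tailSub b T F : Set E) = ⋂ n ∈ F, {x | coord b T n x = 0} := by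
    ext x; simp [mem_tailSub]
  rw [this]
  exact isClosed_biInter fun n _ => isClosed_eq (coord b T n).continuous continuous_const

theorem finiteDimensional_of_inf_tailSub (b : HilbertBasis ι ℂ E) (T : E ≃L[ℂ] E) (F : Finset ι)
    (G : Submodule ℂ E) (h : ∀ x ∈ G, x ∈ tailSub b T F → x = 0) : FiniteDimensional ℂ G := by
  let f : G →ₗ[ℂ] (F → ℂ) := LinearMap.pi fun n => (coord b T n : E →ₗ[ℂ] ℂ).comp G.subtype
  refine FiniteDimensional.of_injective f ?_
  rw [injective_iff_map_eq_zero]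
  intro x hx
  refine Subtype.ext (h x x.2 fun n hn => ?_)
  exact congrFun hx ⟨n, hn⟩

theorem finiteDimensional_quotient_tailSub (b : HilbertBasis ι ℂ E) (T : E ≃L[ℂ] E)
    (F : Finset ι) : FiniteDimensional ℂ (E ⧸ tailSub b T F) := by
  let f : E →ₗ[ℂ] (F → ℂ) := LinearMap.pi fun n => (coord b T n : E →ₗ[ℂ] ℂ)
  have hf : tailSub b T F = LinearMap.ker f := by
    ext x
    rw [LinearMap.mem_ker, mem_tailSub]
    constructor
    · intro h; ext n; exact h n n.2
    · intro h n hn; exact congrFun h ⟨n, hn⟩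
  rw [hf]
  exact f.quotKerEquivRange.symm.finiteDimensional

variable {b : HilbertBasis ι ℂ E} {T : E ≃L[ℂ] E} {F : Finset ι} {R : E →L[ℂ] E} {ν : ι → ℂ}

/-- For `x` in the tail the expansion of `x` contains no `T (b n)` with `n ∈ F`, where nothing is
known about `R`; by continuity `R` acts on it term by term. -/
theorem coord_map_of_mem_tailSub (hR : ∀ n ∉ F, R (T (b n)) = ν n • T (b n)) {x : E}
    (hx : x ∈ tailSub b T F) (m : ι) : coord b T m (R x) = ν m * coord b T m x := by
  classical
  have h := ((hasSum_coord b T x).mapL R).mapL (coord b T m)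
  have h2 : HasSum (fun n => coord b T m (R (coord b T n x • T (b n))))
      (ν m * coord b T m x) := by
    have : ∀ n, coord b T m (R (coord b T n x • T (b n))) =
        if n = m then ν m * coord b T m x else 0 := by
      intro n
      by_cases hn : n ∈ F
      · rw [hx n hn]
        split_ifs with h
        · subst h; simp [hx n hn]
        · simp
      · rw [map_smul, hR n hn, map_smul, map_smul, coord_basis, smul_eq_mul, smul_eq_mul]
        by_cases h : n = m
        · subst h; simp [mul_comm]
        · simp [h, Ne.symm h]
    simp_rw [this]
    convert hasSum_ite_eq m (ν m * coord b T m x) using 1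
  exact h.unique h2

theorem map_mem_tailSub (hR : ∀ n ∉ F, R (T (b n)) = ν n • T (b n)) {x : E}
    (hx : x ∈ tailSub b T F) : R x ∈ tailSub b T F := fun n hn => by
  rw [coord_map_of_mem_tailSub hR hx, hx n hn, mul_zero]

theorem aeval_tailSub (hR : ∀ n ∉ F, R (T (b n)) = ν n • T (b n)) (p : Polynomial ℂ) :
    ∀ x ∈ tailSub b T F, Polynomial.aeval (R : Module.End ℂ E) p x ∈ tailSub b T F ∧
      ∀ m, coord b T m (Polynomial.aeval (R : Module.End ℂ E) p x) =
        p.eval (ν m) * coord b T m x := by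
  have key : ∀ x ∈ tailSub b T F, ∀ m, coord b T m (Polynomial.aeval (R : Module.End ℂ E) p x) =
        p.eval (ν m) * coord b T m x := by
    induction p using Polynomial.induction_on' with
    | add p q hp hq =>
      intro x hx m
      rw [map_add, LinearMap.add_apply, map_add, hp x hx, hq x hx, Polynomial.eval_add, add_mul]
    | monomial k a =>
      intro x hx m
      have h1 : ∀ k : ℕ, ((R : Module.End ℂ E) ^ k) x ∈ tailSub b T F ∧
          coord b T m (((R : Module.End ℂ E) ^ k) x) = ν m ^ k * coord b T m x := by
        intro k
        induction k with
        | zero => simpa using hx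
        | succ k ih =>
          rw [pow_succ', Module.End.mul_apply]
          exact ⟨map_mem_tailSub hR ih.1, by
            rw [ContinuousLinearMap.coe_coe, coord_map_of_mem_tailSub hR ih.1, ih.2, pow_succ']
            ring⟩
      rw [Polynomial.aeval_monomial, Module.End.mul_apply, Module.algebraMap_end_apply, map_smul,
        (h1 k).2, Polynomial.eval_monomial, smul_eq_mul]
      ring
  exact fun x hx => ⟨fun n hn => by rw [key x hx, hx n hn, mul_zero], key x hx⟩

theorem continuous_aeval (R : E →L[ℂ] E) (p : Polynomial ℂ) :
    Continuous (Polynomial.aeval (R : Module.End ℂ E) p) := by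
  induction p using Polynomial.induction_on' with
  | add p q hp hq =>
    rw [map_add]; exact hp.add hq
  | monomial k a =>
    rw [Polynomial.aeval_monomial]
    have : Continuous ((R : Module.End ℂ E) ^ k) := by
      rw [Module.End.coe_pow]; exact R.continuous.iterate k
    exact this.const_smul a

/-- If `R` has dense range, then some polynomial in `R` without a zero at `0` maps into
the tail. -/
theorem exists_aeval_mem_tailSub (hR : ∀ n ∉ F, R (T (b n)) = ν n • T (b n))
    (hd : DenseRange R) :
    ∃ p : Polynomial ℂ, p.eval 0 ≠ 0 ∧
      ∀ x, Polynomial.aeval (R : Module.End ℂ E) p x ∈ tailSub b T F := by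
  have := finiteDimensional_quotient_tailSub b T F
  set M := tailSub b T F with hM
  let R' : Module.End ℂ (E ⧸ M) := M.mapQ M (R : Module.End ℂ E) fun x hx => map_mem_tailSub hR hx
  have hp0 : minpoly ℂ R' ≠ 0 := minpoly.ne_zero (Algebra.IsIntegral.isIntegral R')
  have hcomp : ∀ (p : Polynomial ℂ) (x : E),
      Polynomial.aeval R' p (M.mkQ x) = M.mkQ (Polynomial.aeval (R : Module.End ℂ E) p x) := by
    intro p x
    induction p using Polynomial.induction_on' with
    | add p q hp hq => simp only [map_add, LinearMap.add_apply, hp, hq]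
    | monomial k a =>
      have h1 : ∀ k : ℕ, (R' ^ k) (M.mkQ x) = M.mkQ (((R : Module.End ℂ E) ^ k) x) := by
        intro k
        induction k with
        | zero => simp
        | succ k ih =>
          rw [pow_succ', pow_succ', Module.End.mul_apply, Module.End.mul_apply, ih]
          rfl
      rw [Polynomial.aeval_monomial, Polynomial.aeval_monomial, Module.End.mul_apply,
        Module.End.mul_apply, Module.algebraMap_end_apply, Module.algebraMap_end_apply, h1,
        map_smul]
  -- The minimal polynomial on the quotient is `X^j p` with `p(0) ≠ 0`, so `p(R)` maps the range of
  -- `R^j` into the tail.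
  obtain ⟨p, hp, hnd⟩ := Polynomial.exists_eq_pow_rootMultiplicity_mul_and_not_dvd
    (minpoly ℂ R') hp0 0
  set j := (minpoly ℂ R').rootMultiplicity 0
  refine ⟨p, fun h => hnd (Polynomial.dvd_iff_isRoot.2 h), ?_⟩
  have h0 : ∀ x, Polynomial.aeval (R : Module.End ℂ E) p (R^[j] x) ∈ M := by
    intro x
    have h1 : M.mkQ (Polynomial.aeval (R : Module.End ℂ E) (minpoly ℂ R') x) = 0 := by
      rw [← hcomp, minpoly.aeval, LinearMap.zero_apply]
    rw [Submodule.mkQ_apply, Submodule.Quotient.mk_eq_zero, hp, mul_comm, map_mul, map_pow] at h1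
    simpa [Module.End.mul_apply, Module.End.pow_apply] using h1
  have hdj : DenseRange (R^[j]) := by
    induction j with
    | zero => exact denseRange_id
    | succ j ih =>
      rw [Function.iterate_succ]
      exact ih.comp hd (R.continuous.iterate j)
  -- The range of `R^j` is dense and the preimage of the tail under `p(R)` is closed, which removes
  -- the factor `R^j`.
  intro x
  have hcl : IsClosed {x | Polynomial.aeval (R : Module.End ℂ E) p x ∈ M} :=
    (isClosed_tailSub b T F).preimage (continuous_aeval R p)
  exact hdj.induction_on (p := fun x => Polynomial.aeval (R : Module.End ℂ E) p x ∈ M) x hcl h0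

end Tail

/-! ### Splitting off a finite-dimensional spectral part -/

section Split

variable {ι E : Type*} [NormedAddCommGroup E] [InnerProductSpace ℂ E] [CompleteSpace E]
variable {b : HilbertBasis ι ℂ E} {T : E ≃L[ℂ] E} {F : Finset ι} {R : E →L[ℂ] E} {ν : ι → ℂ}
  {q : Polynomial ℂ}

/-- Outside the finite set `F` the vectors `T (b n)` are eigenvectors of `R` for distinct non-zero
eigenvalues `ν n → 0`, and `q` is a polynomial with `q(R) E` in their closed span, vanishing
neither at `0` nor at these eigenvalues. -/
structure TailSplit (b : HilbertBasis ι ℂ E) (T : E ≃L[ℂ] E) (F : Finset ι) (R : E →L[ℂ] E)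
    (ν : ι → ℂ) (q : Polynomial ℂ) : Prop where
  eig : ∀ n ∉ F, R (T (b n)) = ν n • T (b n)
  inj : InjOn ν {n | n ∉ F}
  ne_zero : ∀ n ∉ F, ν n ≠ 0
  lim : Tendsto ν cofinite (𝓝 0)
  eval_zero : q.eval 0 ≠ 0
  eval_ne : ∀ n ∉ F, q.eval (ν n) ≠ 0
  maps : ∀ x, Polynomial.aeval (R : Module.End ℂ E) q x ∈ tailSub b T F

theorem exists_tailSplit {F₁ : Finset ι} (hR : ∀ n ∉ F₁, R (T (b n)) = ν n • T (b n))
    (hinj : InjOn ν {n | n ∉ F₁}) (hne : ∀ n ∉ F₁, ν n ≠ 0) (hlim : Tendsto ν cofinite (𝓝 0))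
    (hd : DenseRange R) : ∃ F q, F₁ ⊆ F ∧ TailSplit b T F R ν q := by
  classical
  obtain ⟨p, hp0, hp⟩ := exists_aeval_mem_tailSub hR hd
  have hpne : p ≠ 0 := by rintro rfl; simp at hp0
  have hfin : ({n | n ∉ F₁} ∩ ν ⁻¹' {z | p.IsRoot z}).Finite := by
    exact Finite.of_finite_image (f := ν) ((Polynomial.finite_setOfPred_isRoot hpne).subset
      (by rintro _ ⟨n, hn, rfl⟩; exact hn.2)) (hinj.mono inter_subset_left)
  -- The exponent is `2` because the first `p(R)` maps into the tail of `F₁`, and the second then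
  -- annihilates the coordinates whose eigenvalue is a zero of `p`. There are finitely many of these
  -- since `ν` is injective off `F₁`.
  refine ⟨F₁ ∪ hfin.toFinset, p ^ 2, Finset.subset_union_left, ?_⟩
  have hF : ∀ n ∉ F₁ ∪ hfin.toFinset, n ∉ F₁ ∧ p.eval (ν n) ≠ 0 := by
    intro n hn
    rw [Finset.mem_union, not_or] at hn
    refine ⟨hn.1, fun h => hn.2 ?_⟩
    rw [Finite.mem_toFinset]; exact ⟨hn.1, h⟩
  refine ⟨fun n hn => hR n (hF n hn).1, hinj.mono fun n hn => (hF n hn).1,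
    fun n hn => hne n (hF n hn).1, hlim, ?_, fun n hn => ?_, fun x n hn => ?_⟩
  · rw [Polynomial.eval_pow]; exact pow_ne_zero _ hp0
  · rw [Polynomial.eval_pow]; exact pow_ne_zero _ (hF n hn).2
  · rw [sq, map_mul, Module.End.mul_apply, (aeval_tailSub hR p _ (hp x)).2 n]
    rw [Finset.mem_union] at hn
    rcases hn with hn | hn
    · rw [hp x n hn, mul_zero]
    · rw [Finite.mem_toFinset] at hn
      rw [show p.eval (ν n) = 0 from hn.2, zero_mul]

theorem exists_diagonal (b : HilbertBasis ι ℂ E) (T : E ≃L[ℂ] E) (F : Finset ι) {w : ι → ℂ} {C : ℝ}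
    (hw : ∀ n, ‖w n‖ ≤ C) :
    ∃ D : E →L[ℂ] E, (∀ y, D y ∈ tailSub b T F) ∧
      ∀ y, ∀ n ∉ F, coord b T n (D y) = w n * coord b T n y := by
  classical
  have hB := IsBessel.of_orthonormal_comp b {n | n ∉ F} id (injOn_id _) w (C := max C 0)
    (le_max_right _ _) (fun n _ => (hw n).trans (le_max_left _ _))
  obtain ⟨S, hS, -⟩ := hB.exists_operator b
  let D : E →L[ℂ] E := ((T : E →L[ℂ] E).comp S).comp (T.symm : E →L[ℂ] E)
  have key : ∀ n, (coord b T n).comp (D.comp (T : E →L[ℂ] E)) =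
      (if n ∈ F then 0 else w n) • (coord b T n).comp (T : E →L[ℂ] E) := by
    intro n
    refine ext_hilbertBasis b fun i => ?_
    have h1 : D (T (b i)) = T (S (b i)) := by simp [D]
    simp only [ContinuousLinearMap.comp_apply, ContinuousLinearEquiv.coe_coe, h1, hS,
      _root_.smul_apply, coord_basis]
    by_cases hi : i ∈ F
    · by_cases hni : n = i
      · subst hni; simp [hi]
      · simp [hi, hni]
    · simp only [mem_ofPred_eq, hi, not_false_eq_true, indicator_of_mem, id, map_smul, coord_basis]
      by_cases hni : n = i
      · subst hni; simp [hi]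
      · simp [hni]
  have key2 : ∀ n y, coord b T n (D y) = (if n ∈ F then 0 else w n) * coord b T n y := by
    intro n y
    have h1 := congrArg (fun f : E →L[ℂ] ℂ => f (T.symm y)) (key n)
    simpa only [ContinuousLinearMap.comp_apply, ContinuousLinearEquiv.coe_coe, _root_.smul_apply,
      T.apply_symm_apply, smul_eq_mul] using h1
  exact ⟨D, fun y n hn => by rw [key2, if_pos hn, zero_mul],
    fun y n hn => by rw [key2, if_neg hn]⟩

theorem exists_bound_of_tendsto_cofinite {w : ι → ℂ} {a : ℂ} (h : Tendsto w cofinite (𝓝 a)) :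
    ∃ C, ∀ n, ‖w n‖ ≤ C := by
  obtain ⟨C, hC⟩ := (h.norm).bddAbove_range_of_cofinite
  exact ⟨C, fun n => hC ⟨n, rfl⟩⟩

namespace TailSplit

variable (h : TailSplit b T F R ν q)
include h

/-- On the tail `q(R)` is diagonal with entries `q(ν n)`. Their inverses converge to `q(0)⁻¹` and so
are bounded; applying them to `q(R) x` gives the tail component. This is the sum half of `E = M ⊕
ker q(R)`. -/
theorem exists_tail_part (x : E) :
    ∃ y ∈ tailSub b T F, Polynomial.aeval (R : Module.End ℂ E) q (x - y) = 0 := by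
  have hl : Tendsto (fun n => (q.eval (ν n))⁻¹) cofinite (𝓝 (q.eval 0)⁻¹) :=
    ((q.continuous.tendsto 0).comp h.lim).inv₀ h.eval_zero
  obtain ⟨C, hC⟩ := exists_bound_of_tendsto_cofinite hl
  obtain ⟨D, hD, hD'⟩ := exists_diagonal b T F hC
  refine ⟨D (Polynomial.aeval (R : Module.End ℂ E) q x), hD _, ?_⟩
  rw [map_sub, sub_eq_zero]
  refine coord_ext b T fun n => ?_
  rw [(aeval_tailSub h.eig q _ (hD _)).2]
  by_cases hn : n ∈ F
  · rw [h.maps x n hn, hD _ n hn, mul_zero]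
  · rw [hD' _ n hn, mul_inv_cancel_left₀ (h.eval_ne n hn)]

theorem eq_zero_of_mem_tailSub {x : E} (hx : x ∈ tailSub b T F)
    (hq : Polynomial.aeval (R : Module.End ℂ E) q x = 0) : x = 0 := by
  refine coord_ext b T fun n => ?_
  by_cases hn : n ∈ F
  · rw [hx n hn, map_zero]
  · have := (aeval_tailSub h.eig q x hx).2 n
    rw [hq, map_zero, eq_comm, mul_eq_zero] at this
    rw [this.resolve_left (h.eval_ne n hn), map_zero]

omit h in
theorem aeval_X_sub_C_pow (f : Module.End ℂ E) (μ : ℂ) (k : ℕ) :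
    Polynomial.aeval f ((Polynomial.X - Polynomial.C μ) ^ k) =
      (f - μ • (1 : Module.End ℂ E)) ^ k := by
  simp [Algebra.algebraMap_eq_smul_one]

omit h in
theorem isCoprime_of_eval_ne_zero {q : Polynomial ℂ} {μ : ℂ} (hμ : q.eval μ ≠ 0) (k : ℕ) :
    IsCoprime ((Polynomial.X - Polynomial.C μ) ^ k) q :=
  ((Polynomial.irreducible_X_sub_C μ).coprime_iff_not_dvd.2
    fun hd => hμ (Polynomial.dvd_iff_isRoot.1 hd)).pow_left

/-- Bézout for `(X - μ)^k` and `q` writes a generalized eigenvector as `q(R)` applied to something,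
and `q(R)` maps into the tail. -/
theorem mem_tailSub_of_eval_ne_zero {μ : ℂ} (hμ : q.eval μ ≠ 0) {x : E}
    (hx : x ∈ Module.End.maxGenEigenspace (R : Module.End ℂ E) μ) : x ∈ tailSub b T F := by
  obtain ⟨k, hk⟩ := (Module.End.mem_maxGenEigenspace _ _ _).1 hx
  obtain ⟨u, v, huv⟩ := isCoprime_of_eval_ne_zero hμ k
  have h1 := congrArg (fun p => Polynomial.aeval (R : Module.End ℂ E) p x) huv
  simp only [map_add, map_mul, aeval_X_sub_C_pow, LinearMap.add_apply, Module.End.mul_apply, hk,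
    map_zero, zero_add, map_one, Module.End.one_apply] at h1
  rw [← h1, ← Module.End.mul_apply, ← map_mul, mul_comm, map_mul, Module.End.mul_apply]
  exact h.maps _

theorem coord_eq_zero {μ : ℂ} {x : E}
    (hx : x ∈ Module.End.maxGenEigenspace (R : Module.End ℂ E) μ) (hx' : x ∈ tailSub b T F)
    {n : ι} (hn : ν n ≠ μ) : coord b T n x = 0 := by
  obtain ⟨k, hk⟩ := (Module.End.mem_maxGenEigenspace _ _ _).1 hx
  rw [← aeval_X_sub_C_pow] at hk
  have := (aeval_tailSub h.eig ((Polynomial.X - Polynomial.C μ) ^ k) x hx').2 n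
  rw [hk, map_zero, eq_comm, mul_eq_zero] at this
  refine this.resolve_left ?_
  simp only [Polynomial.eval_pow, Polynomial.eval_sub, Polynomial.eval_X, Polynomial.eval_C]
  exact pow_ne_zero _ (sub_ne_zero.2 hn)

theorem maxGenEigenspace_eq_span {n : ι} (hn : n ∉ F) :
    Module.End.maxGenEigenspace (R : Module.End ℂ E) (ν n) = Submodule.span ℂ {T (b n)} := by
  classical
  refine le_antisymm (fun x hx => ?_) ?_
  · have hx' := h.mem_tailSub_of_eval_ne_zero (h.eval_ne n hn) hx
    have : x = coord b T n x • T (b n) := by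
      refine coord_ext b T fun m => ?_
      rw [map_smul, coord_basis]
      by_cases hmn : m = n
      · subst hmn; simp
      · rw [if_neg hmn, smul_zero]
        by_cases hm : m ∈ F
        · exact hx' m hm
        · exact h.coord_eq_zero hx hx' fun hν => hmn (h.inj hm hn hν)
    rw [this]
    exact Submodule.smul_mem _ _ (Submodule.mem_span_singleton_self _)
  · rw [Submodule.span_singleton_le_iff_mem, Module.End.mem_maxGenEigenspace]
    refine ⟨1, ?_⟩
    rw [pow_one, LinearMap.sub_apply, LinearMap.smul_apply, Module.End.one_apply,
      ContinuousLinearMap.coe_coe, h.eig n hn, sub_self]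

/-- The vector `q(R) x` is again a generalized eigenvector for `μ` and lies in the tail, where `(R -
μ)^k` is diagonal with non-zero entries. -/
theorem maxGenEigenspace_le_ker {μ : ℂ} (hμ : ∀ n ∉ F, ν n ≠ μ) :
    Module.End.maxGenEigenspace (R : Module.End ℂ E) μ ≤
      LinearMap.ker (Polynomial.aeval (R : Module.End ℂ E) q) := by
  intro x hx
  rw [LinearMap.mem_ker]
  have hy : Polynomial.aeval (R : Module.End ℂ E) q x ∈
      Module.End.maxGenEigenspace (R : Module.End ℂ E) μ := by
    obtain ⟨k, hk⟩ := (Module.End.mem_maxGenEigenspace _ _ _).1 hx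
    refine (Module.End.mem_maxGenEigenspace _ _ _).2 ⟨k, ?_⟩
    rw [← aeval_X_sub_C_pow, ← Module.End.mul_apply, ← map_mul, mul_comm, map_mul,
      Module.End.mul_apply, aeval_X_sub_C_pow, hk, map_zero]
  refine coord_ext b T fun n => ?_
  rw [map_zero]
  by_cases hn : n ∈ F
  · exact h.maps x n hn
  · exact h.coord_eq_zero hy (h.maps x) (hμ n hn)

theorem finiteDimensional_ker :
    FiniteDimensional ℂ (LinearMap.ker (Polynomial.aeval (R : Module.End ℂ E) q)) :=
  finiteDimensional_of_inf_tailSub b T F _ fun _ hx hx' => h.eq_zero_of_mem_tailSub hx' hx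

/-- The kernel is finite-dimensional and `R`-invariant, hence a sum of generalized eigenspaces over
`ℂ`. An eigenvalue `ν n` with `n ∉ F` contributes nothing, since its vectors lie in the tail, which
meets the kernel trivially. -/
theorem ker_le_iSup :
    LinearMap.ker (Polynomial.aeval (R : Module.End ℂ E) q) ≤
      ⨆ μ ∈ {μ | ∀ n ∉ F, ν n ≠ μ}, Module.End.maxGenEigenspace (R : Module.End ℂ E) μ := by
  have := h.finiteDimensional_ker
  set G := LinearMap.ker (Polynomial.aeval (R : Module.End ℂ E) q) with hG
  have hinv : ∀ x ∈ G, (R : Module.End ℂ E) x ∈ G := by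
    intro x hx
    rw [hG, LinearMap.mem_ker] at hx ⊢
    have : (R : Module.End ℂ E) x = Polynomial.aeval (R : Module.End ℂ E) (Polynomial.X : Polynomial ℂ) x := by
      simp
    rw [this, ← Module.End.mul_apply, ← map_mul, mul_comm, map_mul, Module.End.mul_apply, hx,
      map_zero]
  have htop := Module.End.iSup_maxGenEigenspace_eq_top ((R : Module.End ℂ E).restrict hinv)
  have h1 : G = ⨆ μ, (Module.End.maxGenEigenspace ((R : Module.End ℂ E).restrict hinv) μ).map G.subtype := by
    rw [← Submodule.map_iSup, htop, Submodule.map_subtype_top]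
  rw [h1]
  refine iSup_le fun μ => ?_
  have h2 : (Module.End.maxGenEigenspace ((R : Module.End ℂ E).restrict hinv) μ).map G.subtype ≤
      Module.End.maxGenEigenspace (R : Module.End ℂ E) μ := by
    rw [Submodule.map_le_iff_le_comap]
    exact (Module.End.genEigenspace_restrict _ _ _ _ hinv).le
  by_cases hμ : ∀ n ∉ F, ν n ≠ μ
  · exact h2.trans (le_biSup (fun μ => Module.End.maxGenEigenspace (R : Module.End ℂ E) μ) hμ)
  · push Not at hμ
    obtain ⟨n, hn, rfl⟩ := hμ
    refine le_trans ?_ bot_le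
    intro x hx
    have hxG : x ∈ G := by
      obtain ⟨y, -, rfl⟩ := hx; exact y.2
    exact h.eq_zero_of_mem_tailSub (h.mem_tailSub_of_eval_ne_zero (h.eval_ne n hn) (h2 hx)) hxG

/-- `R - μ` is bijective unless `μ` is `0`, one of the `ν n`, or a zero of `q`. -/
theorem bijective_sub {μ : ℂ} (hμ0 : μ ≠ 0) (hμ : ∀ n ∉ F, ν n ≠ μ) (hq : q.eval μ ≠ 0) :
    Function.Bijective (R - μ • (1 : E →L[ℂ] E)) := by
  constructor
  · rw [injective_iff_map_eq_zero]
    intro x hx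
    have hx1 : x ∈ Module.End.maxGenEigenspace (R : Module.End ℂ E) μ :=
      (Module.End.mem_maxGenEigenspace _ _ _).2 ⟨1, by rw [pow_one]; exact hx⟩
    exact h.eq_zero_of_mem_tailSub (h.mem_tailSub_of_eval_ne_zero hq hx1)
      (h.maxGenEigenspace_le_ker hμ hx1)
  -- The equation is solved on each summand: on the tail by the diagonal operator with entries `(ν n
  -- - μ)⁻¹`, on the kernel of `q(R)` by a Bézout inverse of `X - μ` modulo `q`.
  · intro y
    obtain ⟨y₁, hy₁, hy₂⟩ := h.exists_tail_part y
    have hl : Tendsto (fun n => (ν n - μ)⁻¹) cofinite (𝓝 (0 - μ)⁻¹) :=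
      (h.lim.sub_const μ).inv₀ (by simpa using hμ0)
    obtain ⟨C, hC⟩ := exists_bound_of_tendsto_cofinite hl
    obtain ⟨D, hD, hD'⟩ := exists_diagonal b T F hC
    obtain ⟨u, v, huv⟩ := isCoprime_of_eval_ne_zero hq 1
    have h1 := congrArg (fun p => Polynomial.aeval (R : Module.End ℂ E) p (y - y₁)) huv
    simp only [map_add, map_mul, LinearMap.add_apply, Module.End.mul_apply, hy₂,
      map_zero, add_zero, map_one, Module.End.one_apply] at h1
    rw [← Module.End.mul_apply, ← map_mul, mul_comm, map_mul, Module.End.mul_apply,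
      aeval_X_sub_C_pow, pow_one] at h1
    refine ⟨D y₁ + Polynomial.aeval (R : Module.End ℂ E) u (y - y₁), ?_⟩
    have h2 : (R - μ • (1 : E →L[ℂ] E)) (D y₁) = y₁ := by
      refine coord_ext b T fun n => ?_
      simp only [_root_.sub_apply, _root_.smul_apply,
        _root_.one_apply_eq_self, map_sub, map_smul, coord_map_of_mem_tailSub h.eig (hD y₁),
        smul_eq_mul]
      by_cases hn : n ∈ F
      · rw [hD _ n hn, hy₁ n hn]; simp
      · rw [hD' _ n hn]
        have := sub_ne_zero.2 (hμ n hn)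
        field_simp
    have h3 : (R - μ • (1 : E →L[ℂ] E)) (Polynomial.aeval (R : Module.End ℂ E) u (y - y₁)) =
        y - y₁ := h1
    rw [map_add, h2, h3, add_sub_cancel]

end TailSplit

end Split

/-! ### Root spaces and resolvents -/

section Resolvent

variable {E : Type*} [NormedAddCommGroup E] [InnerProductSpace ℂ E] [CompleteSpace E]
  {A : E →ₗ.[ℂ] E} {z₀ : ℂ} {R : E →L[ℂ] E}

namespace IsResolventAt

variable (hR : IsResolventAt A z₀ R)
include hR

theorem mem_domain (g : E) : R g ∈ A.domain := (hR.1 g).1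

theorem apply_sub (g : E) : A ⟨R g, hR.mem_domain g⟩ - z₀ • R g = g := (hR.1 g).2

theorem injective : Function.Injective R := by
  rw [injective_iff_map_eq_zero]
  intro g hg
  have h1 := hR.apply_sub g
  have h2 : (⟨R g, hR.mem_domain g⟩ : A.domain) = 0 := Subtype.ext hg
  rw [h2, LinearPMap.map_zero, hg, smul_zero, sub_zero] at h1
  exact h1.symm

theorem denseRange (hd : Dense (A.domain : Set E)) : DenseRange R :=
  hd.mono fun f hf => ⟨_, hR.2 ⟨f, hf⟩⟩

/-- The action of `R (A - z)` on `dom A`. -/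
theorem apply_sub_smul (z : ℂ) (f : A.domain) :
    R (A f - z • (f : E)) = f - (z - z₀) • R f := by
  have : A f - z • (f : E) = (A f - z₀ • (f : E)) - (z - z₀) • (f : E) := by
    rw [sub_smul]; abel
  rw [this, map_sub, hR.2, map_smul]

/-- On `dom A` one has `R (A - z) = -(z - z₀) (R - (z - z₀)⁻¹)`. Since `R` is injective and commutes
with the right-hand factor, induction transfers kernels of powers between `A - z` and that factor.
-/
theorem kerPow_eq {z : ℂ} (hz : z ≠ z₀) (n : ℕ) (f : E) :
    f ∈ kerPow A z n ↔ (((R : Module.End ℂ E) - (z - z₀)⁻¹ • 1) ^ n) f = 0 := by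
  have hz' : z - z₀ ≠ 0 := sub_ne_zero.2 hz
  set ν := (z - z₀)⁻¹ with hν
  have hν0 : ν ≠ 0 := inv_ne_zero hz'
  set N : Module.End ℂ E := (R : Module.End ℂ E) - ν • 1 with hN
  have hNap : ∀ x, N x = R x - ν • x := fun x => rfl
  have hcomm : ∀ n x, R ((N ^ n) x) = (N ^ n) (R x) := by
    have hc : Commute (R : Module.End ℂ E) N :=
      (Commute.refl _).sub_right ((Commute.one_right _).smul_right ν)
    intro n x
    exact LinearMap.congr_fun (hc.pow_right n).eq x
  induction n generalizing f with
  | zero => simp [kerPow]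
  | succ n ih =>
    rw [mem_kerPow_succ, pow_succ, Module.End.mul_apply]
    have hkey : ∀ h : f ∈ A.domain, R (A ⟨f, h⟩ - z • f) = -(z - z₀) • N f := by
      intro h
      rw [show A ⟨f, h⟩ - z • f = A ⟨f, h⟩ - z • ((⟨f, h⟩ : A.domain) : E) from rfl,
        hR.apply_sub_smul, hNap, smul_sub, smul_smul, hν, neg_mul, mul_inv_cancel₀ hz']
      simp only [neg_smul, one_smul]
      abel
    constructor
    · rintro ⟨h, hf⟩
      replace hf := (ih _).1 hf
      have h1 := congrArg R hf
      rw [map_zero, hcomm, hkey h, map_smul, smul_eq_zero, neg_eq_zero] at h1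
      exact h1.resolve_left hz'
    · intro hf
      have hg : N f ∈ A.domain := by
        have := (ih (N f)).2 hf
        cases n with
        | zero =>
          rw [kerPow, Submodule.mem_bot] at this
          rw [this]; exact A.domain.zero_mem
        | succ n => exact ((mem_kerPow_succ _ _ _ _).1 this).1
      -- Membership in the domain is automatic: `f` is a combination of `R f` and `N f`, and `N f`
      -- is in the domain by induction.
      have hfd : f ∈ A.domain := by
        have h1 : f = ν⁻¹ • (R f - N f) := by
          rw [hNap, sub_sub_cancel, smul_smul, inv_mul_cancel₀ hν0, one_smul]
        rw [h1]
        exact A.domain.smul_mem _ (A.domain.sub_mem (hR.mem_domain f) hg)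
      refine ⟨hfd, ?_⟩
      refine (ih _).2 ?_
      apply hR.injective
      rw [hcomm, hkey hfd, map_smul, hf, smul_zero, map_zero]

theorem rootSpace_self : rootSpace A z₀ = ⊥ := by
  rw [eq_bot_iff]
  rintro f ⟨n, hn⟩
  rw [Submodule.mem_bot]
  induction n generalizing f with
  | zero => simpa [kerPow] using hn
  | succ n ih =>
    obtain ⟨h, hf⟩ := (mem_kerPow_succ _ _ _ _).1 hn
    have h2 := hR.2 ⟨f, h⟩
    rw [show A ⟨f, h⟩ - z₀ • ((⟨f, h⟩ : A.domain) : E) = 0 from ih hf, map_zero] at h2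
    exact h2.symm

/-- Root spaces of `A` are generalized eigenspaces of its resolvent; the junk value `0⁻¹ = 0`
makes this true at `z₀` as well, where both sides are zero. -/
theorem rootSpace_eq (z : ℂ) :
    rootSpace A z = Module.End.maxGenEigenspace (R : Module.End ℂ E) (z - z₀)⁻¹ := by
  by_cases hz : z = z₀
  · subst hz
    rw [hR.rootSpace_self, eq_comm, eq_bot_iff]
    intro x hx
    obtain ⟨k, hk⟩ := (Module.End.mem_maxGenEigenspace _ _ _).1 hx
    rw [sub_self, inv_zero, zero_smul, sub_zero, Module.End.pow_apply] at hk
    exact hR.injective.iterate k (hk.trans (iterate_map_zero R k).symm)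
  · ext f
    rw [Module.End.mem_maxGenEigenspace]
    exact exists_congr fun n => hR.kerPow_eq hz n f

theorem iSupIndep_rootSpace : iSupIndep (rootSpace A) := by
  have hinj : Function.Injective fun z : ℂ => (z - z₀)⁻¹ :=
    inv_injective.comp (sub_left_injective)
  have := (Module.End.independent_maxGenEigenspace (R : Module.End ℂ E)).comp hinj
  have h2 : rootSpace A = Module.End.maxGenEigenspace (R : Module.End ℂ E) ∘
      fun z : ℂ => (z - z₀)⁻¹ := funext hR.rootSpace_eq
  rw [h2]; exact this

/-- The inverse is explicit: `(A - z)⁻¹ = -(z - z₀)⁻¹ R (R - (z - z₀)⁻¹)⁻¹`. -/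
theorem mem_resolventSetOf {z : ℂ} (hz : z ≠ z₀)
    (hb : Function.Bijective (R - (z - z₀)⁻¹ • (1 : E →L[ℂ] E))) : z ∈ resolventSetOf A := by
  have hz' : z - z₀ ≠ 0 := sub_ne_zero.2 hz
  let e : E ≃L[ℂ] E := ContinuousLinearEquiv.ofBijective (R - (z - z₀)⁻¹ • (1 : E →L[ℂ] E))
    (LinearMap.ker_eq_bot.2 hb.1) (LinearMap.range_eq_top.2 hb.2)
  have he : ∀ x, e x = R x - (z - z₀)⁻¹ • x := fun x => rfl
  let R₁ : E →L[ℂ] E := -(z - z₀)⁻¹ • R.comp (e.symm : E →L[ℂ] E)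
  have hR₁ : ∀ g, R₁ g = R (-(z - z₀)⁻¹ • e.symm g) := fun g => by simp [R₁]
  refine ⟨R₁, fun g => ?_, fun f => ?_⟩
  · set y := -(z - z₀)⁻¹ • e.symm g with hy
    refine ⟨by rw [hR₁]; exact hR.mem_domain _, ?_⟩
    have h1 : (⟨R₁ g, by rw [hR₁]; exact hR.mem_domain _⟩ : A.domain) =
      ⟨R y, hR.mem_domain y⟩ := Subtype.ext (hR₁ g)
    rw [h1, hR₁]
    have h2 := hR.apply_sub y
    have h3 : A ⟨R y, hR.mem_domain y⟩ - z • R y = y - (z - z₀) • R y := by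
      rw [eq_sub_iff_add_eq, ← sub_eq_zero, ← sub_eq_zero.2 h2, sub_smul]; abel
    rw [h3]
    have h4 : e (e.symm g) = g := e.apply_symm_apply g
    rw [he] at h4
    rw [hy, map_smul, smul_smul]
    simp only [neg_smul, mul_neg, mul_inv_cancel₀ hz', one_smul, sub_neg_eq_add]
    rw [neg_add_eq_sub]; exact h4
  · rw [hR₁, map_smul, ← ContinuousLinearEquiv.coe_coe]
    have h2 : R (A f - z • (f : E)) = e (-(z - z₀) • (f : E)) := by
      rw [hR.apply_sub_smul, he, map_smul, smul_smul]
      simp only [mul_neg, inv_mul_cancel₀ hz', neg_smul, one_smul]; abel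
    have h3 : R (e.symm (A f - z • (f : E))) = e.symm (R (A f - z • (f : E))) := by
      apply e.injective
      rw [e.apply_symm_apply, he, ← map_smul, ← map_sub, ← he, e.apply_symm_apply]
    rw [ContinuousLinearEquiv.coe_coe, h3, h2, e.symm_apply_apply, smul_smul]
    rw [neg_mul_neg, inv_mul_cancel₀ hz', one_smul]

end IsResolventAt

theorem mem_spectrumOf_of_rootSpace_ne_bot {z : ℂ} (hz : rootSpace A z ≠ ⊥) : z ∈ spectrumOf A :=
  fun ⟨_, hR⟩ => hz hR.rootSpace_self

end Resolvent

/-! ### Root systems -/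

theorem linearIndependent_of_fiberwise {ι κ M : Type*} [AddCommGroup M] [Module ℂ M]
    {p : κ → Submodule ℂ M} (hp : iSupIndep p) {f : ι → M} {l : ι → κ} (hf : ∀ i, f i ∈ p (l i))
    (hli : ∀ z, LinearIndependent ℂ (fun i : {i : ι // l i = z} => f i)) :
    LinearIndependent ℂ f := by
  classical
  rw [linearIndependent_iff']
  intro s g hg i hi
  have h1 := (iSupIndep_iff_finsetSum_eq_zero_imp_eq_zero p).1 hp (s.image l)
    (fun z => ∑ j ∈ s with l j = z, g j • f j) (fun z _ => Submodule.sum_mem _ fun j hj => by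
      rw [← (Finset.mem_filter.1 hj).2]; exact Submodule.smul_mem _ _ (hf j))
    (by rw [Finset.sum_fiberwise_of_maps_to (fun j hj => Finset.mem_image_of_mem l hj), hg])
    (l i) (Finset.mem_image_of_mem l hi)
  rw [← Finset.sum_subtype_eq_sum_filter] at h1
  exact linearIndependent_iff'.1 (hli (l i)) (s.subtype fun j => l j = l i) (fun j => g j) h1
    ⟨i, rfl⟩ (by simpa using hi)

section Main

variable {E : Type*} [NormedAddCommGroup E] [InnerProductSpace ℂ E] [CompleteSpace E]
variable {A : E →ₗ.[ℂ] E} {z₀ : ℂ} {R : E →L[ℂ] E} {b : HilbertBasis ℤ ℂ E} {T : E ≃L[ℂ] E}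
  {F : Finset ℤ} {lam : ℤ → ℂ} {q : Polynomial ℂ}

theorem inv_sub_injective (z₀ : ℂ) : Function.Injective fun z : ℂ => (z - z₀)⁻¹ :=
  inv_injective.comp sub_left_injective

namespace TailSplit

variable (h : TailSplit b T F R (fun n => (lam n - z₀)⁻¹) q) (hR : IsResolventAt A z₀ R)
include h hR

theorem rootSpace_eq_span {n : ℤ} (hn : n ∉ F) :
    rootSpace A (lam n) = Submodule.span ℂ {T (b n)} := by
  rw [hR.rootSpace_eq]; exact h.maxGenEigenspace_eq_span hn

theorem rootSpace_le_ker {z : ℂ} (hz : ∀ n ∉ F, lam n ≠ z) :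
    rootSpace A z ≤ LinearMap.ker (Polynomial.aeval (R : Module.End ℂ E) q) := by
  rw [hR.rootSpace_eq]
  exact h.maxGenEigenspace_le_ker fun n hn => (inv_sub_injective z₀).ne (hz n hn)

theorem ker_le_iSup_rootSpace :
    LinearMap.ker (Polynomial.aeval (R : Module.End ℂ E) q) ≤
      ⨆ z ∈ {z | ∀ n ∉ F, lam n ≠ z}, rootSpace A z := by
  refine h.ker_le_iSup.trans (iSup₂_le fun μ hμ => ?_)
  -- The convention `0⁻¹ = 0` covers `μ = 0`, which corresponds to `z₀`.
  have h1 : Module.End.maxGenEigenspace (R : Module.End ℂ E) μ = rootSpace A (z₀ + μ⁻¹) := by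
    rw [hR.rootSpace_eq, add_sub_cancel_left, inv_inv]
  rw [h1]
  refine le_biSup (rootSpace A) (i := z₀ + μ⁻¹) fun n hn hl => hμ n hn ?_
  rw [hl, add_sub_cancel_left, inv_inv]

omit h hR in
theorem basis_ne_zero (b : HilbertBasis ℤ ℂ E) (T : E ≃L[ℂ] E) (n : ℤ) : T (b n) ≠ 0 := by
  rw [Ne, T.map_eq_zero_iff]
  exact b.orthonormal.ne_zero n

omit hR in
theorem lam_injOn : InjOn lam {n | n ∉ F} := fun n hn m hm hnm => h.inj hn hm (by
  rw [hnm])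

/-- By `bijective_sub`, a spectral point other than `z₀` and the `lam n`, `n ∉ F`, must make `(z -
z₀)⁻¹` a zero of `q`. -/
theorem finite_spectrum :
    {z | z ∈ spectrumOf A ∧ ∀ n ∉ F, lam n ≠ z}.Finite := by
  have hq : q ≠ 0 := by
    rintro rfl; exact h.eval_zero (by simp)
  have hfin : (insert z₀ ((fun z : ℂ => (z - z₀)⁻¹) ⁻¹' {μ | q.IsRoot μ})).Finite :=
    ((Polynomial.finite_setOfPred_isRoot hq).preimage (inv_sub_injective z₀).injOn).insert _
  refine hfin.subset ?_
  rintro z ⟨hz, hz'⟩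
  by_contra hcon
  rw [mem_insert_iff, not_or] at hcon
  refine hz (hR.mem_resolventSetOf hcon.1 (h.bijective_sub ?_ ?_ hcon.2))
  · exact inv_ne_zero (sub_ne_zero.2 hcon.1)
  · exact fun n hn => (inv_sub_injective z₀).ne (hz' n hn)

/-- The union of bases of all root spaces can be indexed by `ℤ` because it is countable (non-zero
root spaces occur only at the `lam n` and at finitely many further points) and infinite (each `lam
n`, `n ∉ F`, contributes). -/
theorem exists_isRootSystem : ∃ f : ℤ → E, IsRootSystem A f ∧ ∀ n, ‖f n‖ = 1 := by
  classical
  have hfd := h.finiteDimensional_ker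
  have hfdr : ∀ z, FiniteDimensional ℂ (rootSpace A z) := by
    intro z
    by_cases hz : ∀ n ∉ F, lam n ≠ z
    · exact Submodule.finiteDimensional_of_le (h.rootSpace_le_ker hR hz)
    · push Not at hz
      obtain ⟨n, hn, rfl⟩ := hz
      rw [h.rootSpace_eq_span hR hn]
      infer_instance
  let κ := Σ z : ℂ, Fin (Module.finrank ℂ (rootSpace A z))
  have hcount : Countable κ := by
    have hsupp : {z | rootSpace A z ≠ ⊥}.Countable := by
      refine ((countable_range lam).union (h.finite_spectrum hR).countable).mono fun z hz => ?_
      by_cases hz' : ∀ n ∉ F, lam n ≠ z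
      · exact Or.inr ⟨mem_spectrumOf_of_rootSpace_ne_bot hz, hz'⟩
      · push Not at hz'
        obtain ⟨n, -, hn⟩ := hz'
        exact Or.inl ⟨n, hn⟩
    have hinj : Function.Injective
        (fun i : κ => ((⟨i.1, fun hb => by
          have := i.2.pos; rw [hb, finrank_bot] at this; exact lt_irrefl _ this⟩ :
            {z | rootSpace A z ≠ ⊥}), (i.2 : ℕ))) := by
      rintro ⟨z, i⟩ ⟨w, j⟩ hij
      simp only [Prod.mk.injEq, Subtype.mk.injEq] at hij
      obtain ⟨rfl, hij⟩ := hij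
      rw [Fin.ext hij]
    have := hsupp.to_subtype
    exact hinj.countable
  have hinf : Infinite κ := by
    have hpos : ∀ n : {n : ℤ // n ∉ F}, 0 < Module.finrank ℂ (rootSpace A (lam n)) := by
      intro n
      rw [h.rootSpace_eq_span hR n.2, finrank_span_singleton (basis_ne_zero b T n)]
      exact one_pos
    have : Infinite {n : ℤ // n ∉ F} := F.finite_toSet.infinite_compl.to_subtype
    refine Infinite.of_injective (fun n : {n : ℤ // n ∉ F} => (⟨lam n, ⟨0, hpos n⟩⟩ : κ)) ?_
    intro n m hnm
    exact Subtype.ext (h.lam_injOn n.2 m.2 (congrArg Sigma.fst hnm))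
  obtain ⟨hden⟩ := nonempty_denumerable_iff.2 ⟨hcount, hinf⟩
  let e : ℤ ≃ κ := Denumerable.equiv₂ ℤ κ
  let B : ∀ z, Module.Basis (Fin (Module.finrank ℂ (rootSpace A z))) ℂ (rootSpace A z) :=
    fun z => Module.finBasis ℂ _
  let v : κ → E := fun i => (B i.1 i.2 : E)
  have hv : ∀ i, v i ≠ 0 := fun i hi => (B i.1).ne_zero i.2 (Subtype.ext hi)
  let f : ℤ → E := fun n => ((‖v (e n)‖ : ℂ)⁻¹) • v (e n)
  have hc : ∀ n, (‖v (e n)‖ : ℂ)⁻¹ ≠ 0 := fun n => by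
    simpa using hv (e n)
  refine ⟨f, ⟨fun n => (e n).1, fun z => ?_⟩, fun n => ?_⟩
  · let φ : {n : ℤ // (e n).1 = z} ≃ Fin (Module.finrank ℂ (rootSpace A z)) :=
      (e.subtypeEquiv (p := fun n => (e n).1 = z) (q := fun i => i.1 = z) fun n => Iff.rfl).trans
        (Equiv.sigmaSubtype z)
    have hφ : ∀ n : {n : ℤ // (e n).1 = z}, v (e n) = B z (φ n) := by
      rintro ⟨n, rfl⟩
      rfl
    have hli : LinearIndependent ℂ fun n : {n : ℤ // (e n).1 = z} => v (e n) := by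
      have h1 : LinearIndependent ℂ fun i => (B z i : E) :=
        (B z).linearIndependent.map' (rootSpace A z).subtype (Submodule.ker_subtype _)
      have := h1.comp φ φ.injective
      convert this using 1
      ext n; exact hφ n
    constructor
    · exact hli.units_smul (fun n => Units.mk0 _ (hc n))
    · have h1 : Submodule.span ℂ (range fun i => (B z i : E)) = rootSpace A z := by
        have := congrArg (Submodule.map (rootSpace A z).subtype) (B z).span_eq
        rwa [Submodule.map_span, ← range_comp, Submodule.map_subtype_top] at this
      rw [← h1]
      apply le_antisymm
      · rw [Submodule.span_le]
        rintro _ ⟨n, hn, rfl⟩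
        refine Submodule.smul_mem _ _ (Submodule.subset_span ⟨φ ⟨n, hn⟩, ?_⟩)
        exact (hφ ⟨n, hn⟩).symm
      · rw [Submodule.span_le]
        rintro _ ⟨i, rfl⟩
        have h2 : (B z i : E) = v (e (φ.symm i)) := by rw [hφ, φ.apply_symm_apply]
        have h3 : v (e (φ.symm i)) = (‖v (e (φ.symm i))‖ : ℂ) • f (φ.symm i) := by
          simp only [f]
          rw [smul_smul, mul_inv_cancel₀ (by simpa using hv _), one_smul]
        change (B z i : E) ∈ _
        rw [h2, h3]
        exact Submodule.smul_mem _ _ (Submodule.subset_span ⟨_, (φ.symm i).2, rfl⟩)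
  · simp only [f, norm_smul, norm_inv, Complex.norm_real, norm_norm]
    exact inv_mul_cancel₀ (norm_ne_zero_iff.2 (hv _))

/-- Sending `b m` to `f m` defines a bounded operator, the sum of a part `SJ` mapping into the tail
and a part `SI` of finite rank mapping into `ker q(R)`. The splitting of the space makes it
bijective, and the open mapping theorem provides the bounded inverse. -/
theorem isRieszBasis_of_isRootSystem {f : ℤ → E} (hf : IsRootSystem A f)
    {c C : ℝ} (hc : 0 < c) (hb : ∀ n, c ≤ ‖f n‖ ∧ ‖f n‖ ≤ C) : IsRieszBasis f := by
  classical
  obtain ⟨l, hl⟩ := hf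
  set G := LinearMap.ker (Polynomial.aeval (R : Module.End ℂ E) q) with hG
  have hGfd : FiniteDimensional ℂ G := h.finiteDimensional_ker
  have hf0 : ∀ m, f m ≠ 0 := fun m hm => by
    have := (hb m).1
    rw [hm, norm_zero] at this
    exact this.not_gt hc
  have hfl : ∀ m, f m ∈ rootSpace A (l m) := fun m => by
    rw [← (hl (l m)).2]
    exact Submodule.subset_span ⟨m, rfl, rfl⟩
  have hli : LinearIndependent ℂ f :=
    linearIndependent_of_fiberwise hR.iSupIndep_rootSpace hfl fun z => (hl z).1
  -- For `m ∈ J` the vector `f m` is a multiple `a m` of `T (b (nn m))`, since that root space is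
  -- one-dimensional; the remaining `f m` lie in the finite-dimensional `G`.
  let J : Set ℤ := {m | ∃ n ∉ F, lam n = l m}
  have hJ : ∀ m, ∃ n : ℤ, ∃ a : ℂ, m ∈ J → n ∉ F ∧ lam n = l m ∧ f m = a • T (b n) := by
    intro m
    by_cases hm : m ∈ J
    · obtain ⟨n, hn, hnl⟩ := hm
      have h1 := hfl m
      rw [← hnl, h.rootSpace_eq_span hR hn, Submodule.mem_span_singleton] at h1
      obtain ⟨a, ha⟩ := h1
      exact ⟨n, a, fun _ => ⟨hn, hnl, ha.symm⟩⟩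
    · exact ⟨0, 0, fun h => (hm h).elim⟩
  choose nn a hna using hJ
  have hnn : InjOn nn J := by
    intro m hm m' hm' hmm
    have h1 := (hna m hm).2.2
    have h2 := (hna m' hm').2.2
    rw [← hmm] at h2
    have ha' : a m' ≠ 0 := fun h0 => hf0 m' (by rw [h2, h0, zero_smul])
    refine hli.eq_of_smul_apply_eq_smul_apply (a m') (a m) m m' ha' ?_
    rw [h1, h2, smul_smul, smul_smul, mul_comm]
  have hsurj : ∀ n ∉ F, ∃ m ∈ J, nn m = n := by
    intro n hn
    have h1 : ({m | l m = lam n} : Set ℤ).Nonempty := by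
      rw [nonempty_iff_ne_empty]
      intro hemp
      have h2 := (hl (lam n)).2
      rw [hemp, image_empty, Submodule.span_empty, h.rootSpace_eq_span hR hn, eq_comm,
        Submodule.span_singleton_eq_bot] at h2
      exact basis_ne_zero b T n h2
    obtain ⟨m, hm⟩ := h1
    have hmJ : m ∈ J := ⟨n, hn, hm.symm⟩
    exact ⟨m, hmJ, h.lam_injOn (hna m hmJ).1 hn ((hna m hmJ).2.1.trans hm)⟩
  have hIG : ∀ m ∉ J, f m ∈ G := fun m hm =>
    h.rootSpace_le_ker hR (fun n hn hnl => hm ⟨n, hn, hnl⟩) (hfl m)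
  have hIfin : Jᶜ.Finite := by
    have h1 : LinearIndependent ℂ (fun m : (Jᶜ : Set ℤ) => (⟨f m, hIG m m.2⟩ : G)) :=
      LinearIndependent.of_comp G.subtype (hli.comp _ Subtype.val_injective)
    have := h1.finite_of_isNoetherian
    exact toFinite _
  have hGspan : G ≤ Submodule.span ℂ (f '' Jᶜ) := by
    refine (h.ker_le_iSup_rootSpace hR).trans (iSup₂_le fun z hz => ?_)
    rw [← (hl z).2]
    refine Submodule.span_mono (image_mono ?_)
    rintro m rfl ⟨n, hn, hnl⟩
    exact hz n hn hnl
  have hab : ∀ m ∈ J, ‖a m‖ ≤ ‖(T.symm : E →L[ℂ] E)‖ * C ∧ ‖(a m)⁻¹‖ ≤ ‖(T : E →L[ℂ] E)‖ / c := by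
    intro m hm
    have h1 := (hna m hm).2.2
    have h2 : T.symm (f m) = a m • b (nn m) := by rw [h1, map_smul, T.symm_apply_apply]
    have h3 : ‖a m‖ = ‖T.symm (f m)‖ := by
      rw [h2, norm_smul, b.orthonormal.1, mul_one]
    constructor
    · rw [h3]
      refine ((T.symm : E →L[ℂ] E).le_opNorm _).trans ?_
      gcongr
      exact (hb m).2
    · have h4 : c ≤ ‖(T : E →L[ℂ] E)‖ * ‖a m‖ := by
        refine (hb m).1.trans ?_
        rw [h3]
        simpa using (T : E →L[ℂ] E).le_opNorm (T.symm (f m))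
      have ha : 0 < ‖a m‖ := by
        rw [norm_pos_iff]; intro h0; exact hf0 m (by rw [h1, h0, zero_smul])
      rw [norm_inv, inv_eq_one_div, div_le_div_iff₀ ha hc, one_mul]
      exact h4
  obtain ⟨S₀, hS₀, -⟩ := (IsBessel.of_orthonormal_comp b J nn hnn a
    (mul_nonneg (norm_nonneg (T.symm : E →L[ℂ] E)) ((norm_nonneg _).trans (hb 0).2))
    fun m hm => (hab m hm).1).exists_operator b
  let SJ : E →L[ℂ] E := (T : E →L[ℂ] E).comp S₀
  let SI : E →L[ℂ] E := ∑ m ∈ hIfin.toFinset, (innerSL ℂ (b m)).smulRight (f m)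
  have hSJ : ∀ m, SJ (b m) = if m ∈ J then f m else 0 := by
    intro m
    simp only [SJ, ContinuousLinearMap.comp_apply, hS₀]
    by_cases hm : m ∈ J
    · rw [indicator_of_mem hm, if_pos hm, (hna m hm).2.2]; simp
    · rw [indicator_of_notMem hm, if_neg hm, map_zero]
  have hSIx : ∀ x, SI x = ∑ m ∈ hIfin.toFinset, b.repr x m • f m := by
    intro x
    simp [SI, _root_.sum_apply, b.repr_apply_apply]
  have hSI : ∀ m, SI (b m) = if m ∈ J then 0 else f m := by
    intro m
    rw [hSIx]
    simp only [b.repr_self, lp.single_apply, Pi.single_apply, ite_smul, one_smul, zero_smul]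
    rw [Finset.sum_ite_eq']
    by_cases hm : m ∈ J <;> simp [hm]
  have hS : ∀ m, (SJ + SI) (b m) = f m := by
    intro m
    rw [_root_.add_apply, hSJ, hSI]
    split_ifs <;> simp
  have hSJtail : ∀ x, SJ x ∈ tailSub b T F := by
    intro x n hn
    have h1 : (coord b T n).comp SJ = 0 := by
      refine ext_hilbertBasis b fun m => ?_
      rw [ContinuousLinearMap.comp_apply, hSJ, _root_.zero_apply]
      split_ifs with hm
      · rw [(hna m hm).2.2, map_smul, coord_basis, if_neg, smul_zero]
        rintro rfl; exact (hna m hm).1 hn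
      · exact map_zero _
    exact congrArg (fun g : E →L[ℂ] ℂ => g x) h1
  have hSJcoord : ∀ m ∈ J, ∀ x, coord b T (nn m) (SJ x) = a m * b.repr x m := by
    intro m hm x
    have h1 : (coord b T (nn m)).comp SJ = a m • innerSL ℂ (b m) := by
      refine ext_hilbertBasis b fun k => ?_
      rw [ContinuousLinearMap.comp_apply, hSJ, _root_.smul_apply, innerSL_apply_apply,
        orthonormal_iff_ite.1 b.orthonormal]
      split_ifs with hk hmk hmk
      · subst hmk
        rw [(hna m hm).2.2, map_smul, coord_basis, if_pos rfl]
      · rw [(hna k hk).2.2, map_smul, coord_basis, if_neg fun h => hmk (hnn hm hk h), smul_zero,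
          smul_zero]
      · subst hmk; exact (hk hm).elim
      · simp
    have h2 := congrArg (fun g : E →L[ℂ] ℂ => g x) h1
    simpa [b.repr_apply_apply] using h2
  have hSIG : ∀ x, SI x ∈ G := fun x => by
    rw [hSIx]
    exact Submodule.sum_mem _ fun m hm => Submodule.smul_mem _ _ (hIG m (by simpa using hm))
  -- If the sum vanishes, `SI x = -SJ x` lies in `G` and in the tail, so both are zero. The
  -- coordinates on `J` then vanish because `a m ≠ 0`, the others by linear independence.
  have hinj : Function.Injective (SJ + SI) := by
    rw [injective_iff_map_eq_zero]
    intro x hx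
    rw [_root_.add_apply] at hx
    have h1 : SI x = 0 := by
      refine h.eq_zero_of_mem_tailSub ?_ (hSIG x)
      rw [eq_neg_of_add_eq_zero_right hx]
      exact Submodule.neg_mem _ (hSJtail x)
    have h2 : SJ x = 0 := by rwa [h1, add_zero] at hx
    apply b.repr.injective
    ext m
    rw [map_zero, lp.coeFn_zero, Pi.zero_apply]
    by_cases hm : m ∈ J
    · have h3 := hSJcoord m hm x
      rw [h2, map_zero, eq_comm, mul_eq_zero] at h3
      refine h3.resolve_left fun h0 => hf0 m ?_
      rw [(hna m hm).2.2, h0, zero_smul]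
    · rw [hSIx] at h1
      exact linearIndependent_iff'.1 hli _ _ h1 m (by simpa using hm)
  have hGr : (G : Set E) ⊆ range (SJ + SI) := by
    have h1 : G ≤ LinearMap.range ((SJ + SI : E →L[ℂ] E) : E →ₗ[ℂ] E) := by
      refine hGspan.trans (Submodule.span_le.2 ?_)
      rintro _ ⟨m, -, rfl⟩
      exact ⟨b m, hS m⟩
    exact fun x hx => h1 hx
  -- `mm` is a section of `nn` off `F`; with weights `(a (mm n))⁻¹` it yields an operator `D` for
  -- which `D ∘ T⁻¹` is a right inverse of `SJ` on the tail.
  choose! mm hmm using hsurj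
  obtain ⟨D, hD, -⟩ := (IsBessel.of_orthonormal_comp b {n | n ∉ F} mm
    (fun n hn n' hn' hnn' => by rw [← (hmm n hn).2, ← (hmm n' hn').2, hnn'])
    (fun n => (a (mm n))⁻¹) (C := ‖(T : E →L[ℂ] E)‖ / c) (by positivity)
    fun n hn => (hab (mm n) (hmm n hn).1).2).exists_operator b
  have hSD : ∀ y ∈ tailSub b T F, SJ (D (T.symm y)) = y := by
    intro y hy
    refine coord_ext b T fun n => ?_
    by_cases hn : n ∈ F
    · rw [hSJtail _ n hn, hy n hn]
    · have h1 : (coord b T n).comp (SJ.comp D) = (coord b T n).comp (T : E →L[ℂ] E) := by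
        refine ext_hilbertBasis b fun k => ?_
        simp only [ContinuousLinearMap.comp_apply, ContinuousLinearEquiv.coe_coe, coord_basis, hD]
        by_cases hk : k ∈ F
        · rw [indicator_of_notMem (by simpa using hk), map_zero, map_zero, if_neg]
          rintro rfl; exact hn hk
        · obtain ⟨h2, h3⟩ := hmm k hk
          rw [indicator_of_mem (by simpa using hk), map_smul, hSJ, if_pos h2, (hna _ h2).2.2,
            smul_smul, inv_mul_cancel₀, one_smul, h3, coord_basis]
          intro h0; exact hf0 (mm k) (by rw [(hna _ h2).2.2, h0, zero_smul])
      have h2 := congrArg (fun g : E →L[ℂ] ℂ => g (T.symm y)) h1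
      simpa using h2
  have hsur : Function.Surjective (SJ + SI) := by
    intro y
    obtain ⟨y₁, hy₁, hy₂⟩ := h.exists_tail_part y
    obtain ⟨x₂, hx₂⟩ := hGr (show y - y₁ ∈ G from hy₂)
    obtain ⟨x₃, hx₃⟩ := hGr (hSIG (D (T.symm y₁)))
    -- The preimage of the tail part also produces an unwanted `SI` term; that term lies in `G`,
    -- hence in the range, and `x₃` cancels it.
    refine ⟨D (T.symm y₁) - x₃ + x₂, ?_⟩
    rw [map_add, map_sub, hx₂, hx₃, _root_.add_apply, hSD y₁ hy₁]
    abel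
  exact ⟨ContinuousLinearEquiv.ofBijective (SJ + SI) (LinearMap.ker_eq_bot.2 hinj)
    (LinearMap.range_eq_top.2 hsur), b, fun n => (hS n).symm⟩

end TailSplit

end Main

/-! ### Quadratically close eigenvectors -/

section Perturbation

variable {E : Type*} [NormedAddCommGroup E] [InnerProductSpace ℂ E] [CompleteSpace E]

/-- A family quadratically close to an orthonormal basis agrees, up to finitely many members, with
the image of that basis under an isomorphism. -/
theorem exists_equiv_of_summable {ι : Type*} (b : HilbertBasis ι ℂ E) {h : ι → E}
    (hsum : Summable fun n => ‖h n - b n‖ ^ 2) (F₀ : Finset ι) :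
    ∃ (F : Finset ι) (T : E ≃L[ℂ] E), F₀ ⊆ F ∧ ∀ n ∉ F, T (b n) = h n := by
  classical
  -- A square sum of at most `1/4` gives the perturbation `K` norm at most `1/2`, so `1 + K` is
  -- invertible by a Neumann series.
  obtain ⟨s, hs⟩ := summable_iff_vanishing_norm.1 hsum (1 / 4) (by norm_num)
  let F := F₀ ∪ s
  let w : ι → E := fun n => if n ∈ F then 0 else h n - b n
  have hwle : ∀ t : Finset ι, ∑ n ∈ t, ‖w n‖ ^ 2 ≤ 1 / 4 := by
    intro t
    have h1 : ∑ n ∈ t, ‖w n‖ ^ 2 = ∑ n ∈ t.filter (· ∉ F), ‖h n - b n‖ ^ 2 := by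
      rw [Finset.sum_filter]
      refine Finset.sum_congr rfl fun n _ => ?_
      by_cases hn : n ∈ F <;> simp [w, hn]
    have h2 := hs (t.filter (· ∉ F)) (by
      rw [Finset.disjoint_left]
      intro n hn hns
      exact (Finset.mem_filter.1 hn).2 (Finset.mem_union_right _ hns))
    rw [h1]
    exact (le_abs_self _).trans h2.le
  have hws : Summable fun n => ‖w n‖ ^ 2 := summable_of_sum_le (fun n => by positivity) hwle
  obtain ⟨K, hK, hKn⟩ := (IsBessel.of_norm_sq_summable hws).exists_operator b
  have hK1 : ‖-K‖ < 1 := by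
    rw [norm_neg]
    have h2 : √(∑' n, ‖w n‖ ^ 2) ≤ 1 / 2 := by
      rw [Real.sqrt_le_left (by norm_num)]
      refine (hws.tsum_le_of_sum_le hwle).trans (by norm_num)
    linarith
  let T : E ≃L[ℂ] E := ContinuousLinearEquiv.ofUnit (Units.oneSub (-K) hK1)
  have hT : ∀ x, T x = x + K x := fun x => by
    change ((Units.oneSub (-K) hK1 : (E →L[ℂ] E)ˣ) : E →L[ℂ] E) x = _
    rw [Units.val_oneSub]; simp
  refine ⟨F, T, Finset.subset_union_left, fun n hn => ?_⟩
  rw [hT, hK]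
  simp [w, hn]

variable {A : E →ₗ.[ℂ] E} {z₀ : ℂ} {R : E →L[ℂ] E}

theorem exists_tailSplit_of_summable (hd : Dense (A.domain : Set E)) (hR : IsResolventAt A z₀ R)
    (b : HilbertBasis ℤ ℂ E) (S : E ≃L[ℂ] E) {h : ℤ → E}
    (hsum : Summable fun n => ‖h n - b n‖ ^ 2) {F₀ : Finset ℤ} {lam : ℤ → ℂ}
    (hinj : InjOn lam {n | n ∉ F₀}) (hlim : Tendsto (fun n => ‖lam n‖) cofinite atTop)
    (heig : ∀ n ∉ F₀, ∃ hd : S (h n) ∈ A.domain, A ⟨S (h n), hd⟩ = lam n • S (h n)) :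
    ∃ (F : Finset ℤ) (T : E ≃L[ℂ] E) (q : Polynomial ℂ), F₀ ⊆ F ∧
      TailSplit b T F R (fun n => (lam n - z₀)⁻¹) q := by
  obtain ⟨F₁, T₁, hF₁, hT₁⟩ := exists_equiv_of_summable b hsum F₀
  let T := T₁.trans S
  have hT : ∀ n ∉ F₁, T (b n) = S (h n) := fun n hn => by simp [T, hT₁ n hn]
  have hRT : ∀ n ∉ F₁, T (b n) = (lam n - z₀) • R (T (b n)) := by
    intro n hn
    obtain ⟨hd, hA⟩ := heig n (fun h => hn (hF₁ h))
    have h1 := hR.2 ⟨_, hd⟩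
    rw [hA, ← sub_smul, map_smul] at h1
    rw [hT n hn, h1]
  -- If `lam n = z₀`, the relation `hRT` would make `T (b n)` zero.
  have hne : ∀ n ∉ F₁, (lam n - z₀)⁻¹ ≠ 0 := by
    intro n hn h0
    rw [inv_eq_zero] at h0
    have := hRT n hn
    rw [h0, zero_smul] at this
    exact TailSplit.basis_ne_zero b T n this
  have hlim' : Tendsto (fun n => (lam n - z₀)⁻¹) cofinite (𝓝 0) := by
    refine tendsto_inv₀_cobounded.comp ?_
    rw [← tendsto_norm_atTop_iff_cobounded]
    refine tendsto_atTop_mono (fun n => norm_sub_norm_le _ _) ?_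
    exact tendsto_atTop_add_const_right _ _ hlim
  obtain ⟨F, q, hF, hsplit⟩ := exists_tailSplit (b := b) (T := T) (F₁ := F₁) (R := R)
    (ν := fun n => (lam n - z₀)⁻¹) (fun n hn => by
      conv_rhs => rw [hRT n hn]
      rw [smul_smul, inv_mul_cancel₀ fun h0 => hne n hn (by rw [h0, inv_zero]), one_smul])
    ((inv_sub_injective z₀).comp_injOn (hinj.mono fun n hn h => hn (hF₁ h))) hne hlim'
    (hR.denseRange hd)
  exact ⟨F, T, q, hF₁.trans hF, hsplit⟩

end Perturbation

/-! ### The differential equation -/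

section AC

theorem absolutelyContinuous_integral {g : ℝ → ℂ} {a b : ℝ} (hg : IntervalIntegrable g volume a b) :
    AbsolutelyContinuousOnInterval (fun x => ∫ t in a..x, g t) a b := by
  have hre : IntervalIntegrable (fun t => (g t).re) volume a b := ⟨hg.1.re, hg.2.re⟩
  have him : IntervalIntegrable (fun t => (g t).im) volume a b := ⟨hg.1.im, hg.2.im⟩
  have h1 := hre.absolutelyContinuousOnInterval_intervalIntegral (c := a) left_mem_uIcc
  have h2 := him.absolutelyContinuousOnInterval_intervalIntegral (c := a) left_mem_uIcc
  have hc : ∀ c : ℂ, AbsolutelyContinuousOnInterval (fun _ : ℝ => c) a b := fun c =>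
    (LipschitzWith.const' c (K := 0)).lipschitzOnWith.absolutelyContinuousOnInterval
  have h3 := (h1.fun_smul (hc 1)).fun_add (h2.fun_smul (hc Complex.I))
  have key : ∀ x ∈ uIcc a b, ∫ t in a..x, g t =
      (∫ t in a..x, (g t).re) • (1 : ℂ) + (∫ t in a..x, (g t).im) • Complex.I := by
    intro x hx
    have hs : uIcc a x ⊆ uIcc a b := uIcc_subset_uIcc_left hx
    have hr' := hre.mono_set hs
    have hi' := him.mono_set hs
    rw [← intervalIntegral.integral_smul_const, ← intervalIntegral.integral_smul_const,
      ← intervalIntegral.integral_add ⟨hr'.1.smul_const _, hr'.2.smul_const _⟩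
        ⟨hi'.1.smul_const _, hi'.2.smul_const _⟩]
    refine intervalIntegral.integral_congr fun t _ => ?_
    simp
  rw [absolutelyContinuousOnInterval_iff] at h3 ⊢
  intro ε hε
  obtain ⟨δ, hδ, h⟩ := h3 ε hε
  refine ⟨δ, hδ, fun I hI hI' => ?_⟩
  convert h I hI hI' using 4 with i hi
  · exact key _ (hI.1 i hi).1
  · exact key _ (hI.1 i hi).2

theorem absolutelyContinuous_comp {X Y : Type*} [PseudoMetricSpace X] [PseudoMetricSpace Y]
    {f : ℝ → X} {a b : ℝ} (hf : AbsolutelyContinuousOnInterval f a b) {φ : X → Y} {s : Set X}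
    {K : NNReal} (hφ : LipschitzOnWith K φ s) (hs : MapsTo f (uIcc a b) s) :
    AbsolutelyContinuousOnInterval (fun x => φ (f x)) a b := by
  rw [absolutelyContinuousOnInterval_iff] at hf ⊢
  intro ε hε
  obtain ⟨δ, hδ, h⟩ := hf (ε / (K + 1)) (by positivity)
  refine ⟨δ, hδ, fun I hI hI' => ?_⟩
  have h1 := h I hI hI'
  calc ∑ i ∈ Finset.range I.1, dist (φ (f (I.2 i).1)) (φ (f (I.2 i).2))
      ≤ ∑ i ∈ Finset.range I.1, K * dist (f (I.2 i).1) (f (I.2 i).2) := by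
        refine Finset.sum_le_sum fun i hi => ?_
        exact hφ.dist_le_mul _ (hs (hI.1 i hi).1) _ (hs (hI.1 i hi).2)
    _ = K * ∑ i ∈ Finset.range I.1, dist (f (I.2 i).1) (f (I.2 i).2) := by rw [Finset.mul_sum]
    _ ≤ (K + 1) * ∑ i ∈ Finset.range I.1, dist (f (I.2 i).1) (f (I.2 i).2) := by
        exact mul_le_mul_of_nonneg_right (lt_add_one _).le
          (Finset.sum_nonneg fun i _ => dist_nonneg)
    _ < (K + 1) * (ε / (K + 1)) := by gcongr
    _ = ε := by field_simp

theorem absolutelyContinuous_cexp {f : ℝ → ℂ} {a b : ℝ}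
    (hf : AbsolutelyContinuousOnInterval f a b) :
    AbsolutelyContinuousOnInterval (fun x => Complex.exp (f x)) a b := by
  obtain ⟨C, hC⟩ := hf.exists_bound
  obtain ⟨K, hK⟩ := (Complex.contDiff_exp (𝕜 := ℝ) (n := 1)).contDiffOn.exists_lipschitzOnWith
    (s := Metric.closedBall (0 : ℂ) C) one_ne_zero (convex_closedBall _ _)
    (isCompact_closedBall _ _)
  exact absolutelyContinuous_comp hf hK fun x hx => by simpa using hC x hx

/-- Variation of constants for `F' = v F + g` with integrable coefficients. -/
theorem variation_of_constants {v g : ℝ → ℂ} {L : ℝ} (hL : 0 ≤ L)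
    (hv : IntervalIntegrable v volume 0 L) (hg : IntervalIntegrable g volume 0 L) (a : ℂ)
    {F : ℝ → ℂ} (hF : F = fun x => Complex.exp (∫ t in (0 : ℝ)..x, v t) *
      (a + ∫ t in (0 : ℝ)..x, Complex.exp (-∫ s in (0 : ℝ)..t, v s) * g t)) :
    ContinuousOn F (Icc 0 L) ∧
    ∀ x ∈ Icc 0 L, F x = F 0 + ∫ t in (0 : ℝ)..x, (v t * F t + g t) := by
  have hW := absolutelyContinuous_integral hv
  have hE := absolutelyContinuous_cexp hW
  have hE' := absolutelyContinuous_cexp hW.fun_neg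
  have hg' : IntervalIntegrable (fun t => Complex.exp (-∫ s in (0 : ℝ)..t, v s) * g t) volume 0 L :=
    hg.continuousOn_mul hE'.continuousOn
  have hu := absolutelyContinuous_integral hg'
  have hc : AbsolutelyContinuousOnInterval (fun _ : ℝ => a) 0 L :=
    (LipschitzWith.const' a (K := 0)).lipschitzOnWith.absolutelyContinuousOnInterval
  have hFac : AbsolutelyContinuousOnInterval F 0 L := by
    rw [hF]; exact hE.fun_smul (hc.fun_add hu)
  have hFc := hFac.continuousOn
  have hint : IntervalIntegrable (fun t => v t * F t + g t) volume 0 L :=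
    (hv.mul_continuousOn hFc).add hg
  rw [uIcc_of_le hL] at hFc
  refine ⟨hFc, ?_⟩
  -- The difference of `F` and the integral is absolutely continuous with derivative zero almost
  -- everywhere, hence constant.
  have hD := hFac.fun_sub (absolutelyContinuous_integral hint)
  obtain ⟨C, hC⟩ := hD.const_of_ae_hasDerivAt_zero (by
    filter_upwards [hv.ae_hasDerivAt_integral, hg'.ae_hasDerivAt_integral,
      hint.ae_hasDerivAt_integral] with x h1 h2 h3 hx
    have d1 := (h1 hx 0 left_mem_uIcc).cexp
    have d2 := (h2 hx 0 left_mem_uIcc).const_add a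
    have d3 := h3 hx 0 left_mem_uIcc
    have d4 : HasDerivAt F (Complex.exp (∫ t in (0 : ℝ)..x, v t) * v x *
        (a + ∫ t in (0 : ℝ)..x, Complex.exp (-∫ s in (0 : ℝ)..t, v s) * g t) +
        Complex.exp (∫ t in (0 : ℝ)..x, v t) *
          (Complex.exp (-∫ s in (0 : ℝ)..x, v s) * g x)) x := by
      rw [hF]; exact d1.mul d2
    refine (d4.sub d3).congr_deriv ?_
    rw [hF]
    have h5 : Complex.exp (∫ t in (0 : ℝ)..x, v t) *
      (Complex.exp (-∫ s in (0 : ℝ)..x, v s) * g x) = g x := by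
      rw [← mul_assoc, ← Complex.exp_add, add_neg_cancel, Complex.exp_zero, one_mul]
    rw [h5]
    ring)
  intro x hx
  rw [uIcc_of_le hL] at hC
  have h1 := hC x hx
  have h0 := hC 0 (left_mem_Icc.2 hL)
  rw [intervalIntegral.integral_same, sub_zero] at h0
  rw [h0, ← h1]; ring

end AC

/-! ### Explicit solutions as elements of the domain -/

section Operator

theorem memLp_of_continuousOn {F : ℝ → ℂ} (hF : ContinuousOn F (Icc 0 (2 * Real.pi))) :
    MemLp F 2 mu := by
  obtain ⟨C, hC⟩ := isCompact_Icc.exists_bound_of_continuousOn hF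
  refine MemLp.of_bound ((hF.mono Ioo_subset_Icc_self).aestronglyMeasurable measurableSet_Ioo) C ?_
  rw [ae_restrict_iff' measurableSet_Ioo]
  exact Eventually.of_forall fun x hx => hC x (Ioo_subset_Icc_self hx)

/-- The class in `L²(0, 2π)` of a function continuous on `[0, 2π]`. -/
def toH (F : ℝ → ℂ) (hF : ContinuousOn F (Icc 0 (2 * Real.pi))) : H :=
  (memLp_of_continuousOn hF).toLp F

theorem coeFn_toH {F : ℝ → ℂ} (hF : ContinuousOn F (Icc 0 (2 * Real.pi))) :
    toH F hF =ᵐ[mu] F := MemLp.coeFn_toLp _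

theorem coeFn_mulOp (V : LInfty) (f : H) : mulOp V f =ᵐ[mu] fun x => V x * f x :=
  Lp.coeFn_lpSMul V f

theorem intervalIntegrable_linfty (V : LInfty) {x : ℝ} (hx : x ∈ Icc 0 (2 * Real.pi)) :
    IntervalIntegrable V volume 0 x := by
  have h1 : Integrable V mu := (Lp.memLp V).integrable le_top
  have h2 : IntegrableOn V (Ioc 0 (2 * Real.pi)) volume :=
    (integrableOn_Ioc_iff_integrableOn_Ioo).2 h1
  exact (intervalIntegrable_iff_integrableOn_Ioc_of_le hx.1).2
    (h2.mono_set (Ioc_subset_Ioc_right hx.2))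

/-- Uniqueness of the representative and of the derivative allows the chosen `acRep` and `derivFun`
to be replaced by any explicit pair. -/
theorem mem_domain_opA {V : LInfty} {ρ : ℂ} {k : H} {f g : H} {F : ℝ → ℂ} (h : IsACRep f F g)
    (hbc : F 0 = ρ * F (2 * Real.pi)) :
    ∃ hd : f ∈ (opA V ρ k).domain,
      opA V ρ k ⟨f, hd⟩ = Complex.I • g + mulOp V f + F (2 * Real.pi) • k := by
  have hf1 : f ∈ H1 := ⟨F, g, h⟩
  have hE : EqOn (acRep ⟨f, hf1⟩) F (Icc 0 (2 * Real.pi)) := (isACRep ⟨f, hf1⟩).eqOn h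
  have hl : evalLeft ⟨f, hf1⟩ = F 0 := hE (left_mem_Icc.2 two_pi_pos.le)
  have hr : evalRight ⟨f, hf1⟩ = F (2 * Real.pi) := hE (right_mem_Icc.2 two_pi_pos.le)
  have hdv : derivL ⟨f, hf1⟩ = g := (isACRep ⟨f, hf1⟩).deriv_unique h
  have hmem : (⟨f, hf1⟩ : H1) ∈ bcSubspace ρ := by
    rw [bcSubspace, LinearMap.mem_ker, LinearMap.sub_apply, LinearMap.smul_apply, hl, hr, hbc,
      smul_eq_mul, sub_self]
  refine ⟨⟨⟨f, hf1⟩, hmem, rfl⟩, ?_⟩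
  change action V k ⟨f, hf1⟩ = _
  simp [action, hdv, hr]

/-- The solution of `i F' + (V - z) F = i g` with `F 0 = a`. -/
def solFun (V : LInfty) (z a : ℂ) (g : ℝ → ℂ) : ℝ → ℂ := fun x =>
  Complex.exp (∫ t in (0 : ℝ)..x, Complex.I * (V t - z)) *
    (a + ∫ t in (0 : ℝ)..x, Complex.exp (-∫ s in (0 : ℝ)..t, Complex.I * (V s - z)) * g t)

theorem solFun_zero (V : LInfty) (z a : ℂ) (g : ℝ → ℂ) : solFun V z a g 0 = a := by
  simp [solFun]

theorem intervalIntegrable_potential (V : LInfty) (z : ℂ) {x : ℝ} (hx : x ∈ Icc 0 (2 * Real.pi)) :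
    IntervalIntegrable (fun t => Complex.I * (V t - z)) volume 0 x :=
  ((intervalIntegrable_linfty V hx).sub intervalIntegrable_const).const_mul _

theorem continuousOn_solFun (V : LInfty) (z a : ℂ) (g : H) :
    ContinuousOn (solFun V z a g) (Icc 0 (2 * Real.pi)) := by
  have hr := right_mem_Icc.2 two_pi_pos.le
  exact (variation_of_constants two_pi_pos.le (intervalIntegrable_potential V z hr)
    (intervalIntegrable_coe g hr) a rfl).1

theorem isACRep_solFun (V : LInfty) (z a : ℂ) (g : H) :
    IsACRep (toH _ (continuousOn_solFun V z a g)) (solFun V z a g)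
      (Complex.I • (mulOp V (toH _ (continuousOn_solFun V z a g)) -
        z • toH _ (continuousOn_solFun V z a g)) + g) where
  ae_eq := coeFn_toH _
  eq_integral x hx := by
    have hr := right_mem_Icc.2 two_pi_pos.le
    rw [(variation_of_constants two_pi_pos.le (intervalIntegrable_potential V z hr)
      (intervalIntegrable_coe g hr) a rfl : ContinuousOn (solFun V z a g) _ ∧ _).2 x hx]
    congr 1
    refine integral_congr_coe ?_ hx
    set f := toH _ (continuousOn_solFun V z a g)
    filter_upwards [Lp.coeFn_add (Complex.I • (mulOp V f - z • f)) g,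
      Lp.coeFn_smul Complex.I (mulOp V f - z • f), Lp.coeFn_sub (mulOp V f) (z • f),
      Lp.coeFn_smul z f, coeFn_mulOp V f, coeFn_toH (continuousOn_solFun V z a g)]
      with t h1 h2 h3 h4 h5 h6
    rw [h1, Pi.add_apply, h2, Pi.smul_apply, h3, Pi.sub_apply, h4, h5, Pi.smul_apply, h6]
    simp only [smul_eq_mul]
    ring

end Operator

/-! ### Dissipativity and the resolvent set -/

section Dissipative

variable {E : Type*} [NormedAddCommGroup E] [InnerProductSpace ℂ E] {A : E →ₗ.[ℂ] E}

/-- Cauchy–Schwarz applied to `Im ⟨f, (A - z) f⟩ ≥ -Im z ‖f‖²`. In the lower half plane it gives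
injectivity and the bound `1 / |Im z|` for the inverse. -/
theorem IsDissipative.norm_le (hA : IsDissipative A) (z : ℂ) (f : A.domain) :
    -z.im * ‖(f : E)‖ ≤ ‖A f - z • (f : E)‖ := by
  have h1 : (inner ℂ (f : E) (A f - z • (f : E))).im =
      (inner ℂ (f : E) (A f)).im - z.im * ‖(f : E)‖ ^ 2 := by
    have h0 : inner ℂ (f : E) (f : E) = ((‖(f : E)‖ ^ 2 : ℝ) : ℂ) := by
      rw [inner_self_eq_norm_sq_to_K]; simp
    rw [inner_sub_right, inner_smul_right, h0, Complex.sub_im, Complex.im_mul_ofReal]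
  have h2 : (inner ℂ (f : E) (A f - z • (f : E))).im ≤ ‖(f : E)‖ * ‖A f - z • (f : E)‖ :=
    (Complex.im_le_norm _).trans (norm_inner_le_norm _ _)
  have h3 := hA.2 f
  rcases (norm_nonneg (f : E)).eq_or_lt with h0 | h0
  · rw [← h0, mul_zero]; positivity
  · refine le_of_mul_le_mul_left ?_ h0
    nlinarith

theorem IsDissipative.mem_resolventSetOf (hA : IsDissipative A) {z : ℂ} (hz : z.im < 0)
    (hs : ∀ y : E, ∃ f : A.domain, A f - z • (f : E) = y) : z ∈ resolventSetOf A := by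
  have hz' : 0 < -z.im := by linarith
  have huniq : ∀ f g : A.domain, A f - z • (f : E) = A g - z • (g : E) → f = g := by
    intro f g hfg
    have h1 := hA.norm_le z (f - g)
    have h2 : A (f - g) - z • ((f - g : A.domain) : E) = 0 := by
      rw [A.map_sub, Submodule.coe_sub, smul_sub, ← sub_eq_zero.2 hfg]; abel
    rw [h2, norm_zero] at h1
    have h3 : ‖((f - g : A.domain) : E)‖ ≤ 0 := by nlinarith [norm_nonneg ((f - g : A.domain) : E)]
    exact sub_eq_zero.1 (Subtype.ext (norm_le_zero_iff.1 h3))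
  choose r hr using hs
  let R₀ : E →ₗ[ℂ] E :=
    { toFun := fun y => r y
      map_add' := fun x y => by
        rw [← Submodule.coe_add]
        congr 1
        apply huniq
        rw [hr, A.map_add, Submodule.coe_add, smul_add, add_sub_add_comm, hr, hr]
      map_smul' := fun c x => by
        rw [RingHom.id_apply, ← Submodule.coe_smul]
        congr 1
        apply huniq
        rw [hr, A.map_smul, Submodule.coe_smul, smul_comm z c, ← smul_sub, hr] }
  have hb : ∀ y, ‖R₀ y‖ ≤ (-z.im)⁻¹ * ‖y‖ := by
    intro y
    have := hA.norm_le z (r y)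
    rw [hr] at this
    rw [inv_mul_eq_div, le_div_iff₀' hz']
    exact this
  refine ⟨R₀.mkContinuous _ hb, fun g => ⟨(r g).2, hr g⟩, fun f => ?_⟩
  change (r _ : E) = f
  congr 1
  exact huniq _ _ (hr _)

theorem IsDissipative.im_nonneg (hA : IsDissipative A) {z : ℂ} {f : A.domain} (hf : (f : E) ≠ 0)
    (hz : A f = z • (f : E)) : 0 ≤ z.im := by
  have h1 := hA.norm_le z f
  rw [hz, sub_self, norm_zero] at h1
  have := norm_pos_iff.2 hf
  nlinarith

end Dissipative

/-! ### Characteristic equation and the lower half plane -/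

section Solve

theorem solFun_add_smul (V : LInfty) (z c a a' : ℂ) (g g' : H) {x : ℝ}
    (hx : x ∈ Icc 0 (2 * Real.pi)) :
    solFun V z (c * a + a') (c • g + g' : H) x = c * solFun V z a g x + solFun V z a' g' x := by
  have hE : ContinuousOn (fun t => Complex.exp (-∫ s in (0 : ℝ)..t, Complex.I * (V s - z)))
      (uIcc 0 x) := by
    refine (absolutelyContinuous_cexp (absolutelyContinuous_integral
      (intervalIntegrable_potential V z hx)).fun_neg).continuousOn
  have h1 : ∫ t in (0 : ℝ)..x, Complex.exp (-∫ s in (0 : ℝ)..t, Complex.I * (V s - z)) *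
      (c • g + g' : H) t =
      c * (∫ t in (0 : ℝ)..x, Complex.exp (-∫ s in (0 : ℝ)..t, Complex.I * (V s - z)) * g t) +
      ∫ t in (0 : ℝ)..x, Complex.exp (-∫ s in (0 : ℝ)..t, Complex.I * (V s - z)) * g' t := by
    rw [← intervalIntegral.integral_const_mul, ← intervalIntegral.integral_add
      (((intervalIntegrable_coe g hx).continuousOn_mul hE).const_mul c)
      ((intervalIntegrable_coe g' hx).continuousOn_mul hE)]
    refine integral_congr_coe ?_ hx
    filter_upwards [Lp.coeFn_add (c • g) g', Lp.coeFn_smul c g] with t h1 h2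
    rw [h1, Pi.add_apply, h2, Pi.smul_apply, smul_eq_mul]; ring
  rw [solFun, solFun, solFun, h1]; ring

variable {V : LInfty} {ρ : ℂ} {k : H}

/-- The unknown boundary value enters as a parameter `c`; the hypothesis is the consistency
condition that the solution built with `c` has the value `c` at `2π`. -/
theorem opA_solFun {z c : ℂ} {y : H}
    (hc : solFun V z (ρ * c) (Complex.I • (c • k - y) : H) (2 * Real.pi) = c) :
    ∃ hd : toH _ (continuousOn_solFun V z (ρ * c) (Complex.I • (c • k - y))) ∈ (opA V ρ k).domain,
      opA V ρ k ⟨_, hd⟩ =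
        z • toH _ (continuousOn_solFun V z (ρ * c) (Complex.I • (c • k - y))) + y := by
  obtain ⟨hd, h⟩ := mem_domain_opA (V := V) (k := k) (ρ := ρ)
    (isACRep_solFun V z (ρ * c) (Complex.I • (c • k - y))) (by rw [solFun_zero, hc])
  refine ⟨hd, ?_⟩
  rw [h, hc, smul_add, smul_smul, smul_smul, Complex.I_mul_I]
  simp only [neg_smul, one_smul]
  abel

/-- The solution with value `ρ` at `0` of the eigenvalue equation normalized by `f(2π) = 1`. -/
def eigFun (V : LInfty) (ρ : ℂ) (k : H) (z : ℂ) : ℝ → ℂ := solFun V z ρ (Complex.I • k : H)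

theorem continuousOn_eigFun (V : LInfty) (ρ : ℂ) (k : H) (z : ℂ) :
    ContinuousOn (eigFun V ρ k z) (Icc 0 (2 * Real.pi)) := continuousOn_solFun _ _ _ _

theorem opA_eigFun {z : ℂ} (hz : eigFun V ρ k z (2 * Real.pi) = 1) :
    ∃ hd : toH _ (continuousOn_eigFun V ρ k z) ∈ (opA V ρ k).domain,
      opA V ρ k ⟨_, hd⟩ = z • toH _ (continuousOn_eigFun V ρ k z) := by
  have h := opA_solFun (V := V) (ρ := ρ) (k := k) (z := z) (c := 1) (y := 0)
  simp only [mul_one, one_smul, sub_zero, add_zero] at h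
  exact h hz

theorem toH_eigFun_ne_zero {z : ℂ} (hz : eigFun V ρ k z (2 * Real.pi) = 1) :
    toH _ (continuousOn_eigFun V ρ k z) ≠ 0 := by
  intro h0
  have h1 := isACRep_solFun V z ρ (Complex.I • k)
  have h2 : toH _ (continuousOn_solFun V z ρ (Complex.I • k : H)) = 0 := h0
  rw [h2] at h1
  have h3 := h1.eqOn IsACRep.zero (right_mem_Icc.2 two_pi_pos.le)
  rw [Pi.zero_apply] at h3
  exact one_ne_zero (hz.symm.trans h3)

theorem exists_opA_sub_eq {z : ℂ} (hz : eigFun V ρ k z (2 * Real.pi) ≠ 1) (y : H) :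
    ∃ f : (opA V ρ k).domain, opA V ρ k f - z • (f : H) = y := by
  have hr := right_mem_Icc.2 two_pi_pos.le
  set N := eigFun V ρ k z (2 * Real.pi) with hN
  set M := solFun V z 0 (-Complex.I • y : H) (2 * Real.pi) with hM
  have hz' : 1 - N ≠ 0 := sub_ne_zero.2 (Ne.symm hz)
  -- By linearity of `solFun` in its data, consistency reads `c = c N + M`, solvable since `N ≠ 1`.
  set c := M / (1 - N) with hc
  have h1 : solFun V z (ρ * c) (Complex.I • (c • k - y) : H) (2 * Real.pi) = c := by
    have h2 : (Complex.I • (c • k - y) : H) = c • (Complex.I • k) + -Complex.I • y := by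
      rw [smul_sub, smul_comm, neg_smul, sub_eq_add_neg]
    have h3 := solFun_add_smul V z c ρ 0 (Complex.I • k) (-Complex.I • y) hr
    rw [h2, mul_comm ρ c, ← add_zero (c * ρ), h3, ← hM]
    change c * N + M = c
    rw [hc]; field_simp; ring
  obtain ⟨hd, h⟩ := opA_solFun h1
  exact ⟨⟨_, hd⟩, by rw [h]; exact add_sub_cancel_left _ _⟩

/-- Either the resolvent equation is solvable for all right-hand sides, or `eigFun` is an
eigenfunction; dissipativity excludes the latter below the real axis. -/
theorem mem_resolventSetOf_opA (hA : IsDissipative (opA V ρ k)) {z : ℂ} (hz : z.im < 0) :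
    z ∈ resolventSetOf (opA V ρ k) := by
  refine hA.mem_resolventSetOf hz (exists_opA_sub_eq fun h1 => ?_)
  obtain ⟨hd, h⟩ := opA_eigFun h1
  exact (hA.im_nonneg (f := ⟨_, hd⟩) (toH_eigFun_ne_zero h1) h).not_gt hz

end Solve

/-! ### Dissipativity bounds the boundary parameter -/

section BoundaryParameter

theorem isACRep_of_hasDerivAt {F F' : ℝ → ℂ} (hF : ∀ x, HasDerivAt F (F' x) x)
    (hFc : Continuous F) (hF' : Continuous F') :
    IsACRep (toH F hFc.continuousOn) F (toH F' hF'.continuousOn) where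
  ae_eq := coeFn_toH _
  eq_integral x hx := by
    rw [integral_congr_coe (coeFn_toH hF'.continuousOn) hx,
      intervalIntegral.integral_eq_sub_of_hasDerivAt (fun t _ => hF t)
        (hF'.intervalIntegrable _ _)]
    ring

theorem re_inner_deriv {F F' : ℝ → ℂ} (hF : ∀ x, HasDerivAt F (F' x) x)
    (hFc : Continuous F) (hF' : Continuous F') :
    (inner ℂ (toH F hFc.continuousOn) (toH F' hF'.continuousOn)).re =
      (‖F (2 * Real.pi)‖ ^ 2 - ‖F 0‖ ^ 2) / 2 := by
  have h1 : ∫ t in (0 : ℝ)..(2 * Real.pi), 2 * inner ℝ (F t) (F' t) =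
      ‖F (2 * Real.pi)‖ ^ 2 - ‖F 0‖ ^ 2 :=
    intervalIntegral.integral_eq_sub_of_hasDerivAt (fun t _ => (hF t).norm_sq)
      ((continuous_const.mul (hFc.inner hF')).intervalIntegrable _ _)
  rw [intervalIntegral.integral_const_mul] at h1
  rw [← h1, mul_div_cancel_left₀ _ two_ne_zero, L2.inner_def,
    intervalIntegral.integral_of_le two_pi_pos.le, integral_Ioc_eq_integral_Ioo]
  rw [← RCLike.re_eq_complex_re, ← integral_re (L2.integrable_inner _ _)]
  refine integral_congr_ae ?_
  filter_upwards [coeFn_toH hFc.continuousOn, coeFn_toH hF'.continuousOn] with t h2 h3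
  rw [h2, h3]
  simp [Complex.inner]

theorem norm_sq_toH {F : ℝ → ℂ} (hF : ContinuousOn F (Icc 0 (2 * Real.pi))) :
    ‖toH F hF‖ ^ 2 = ∫ t, ‖F t‖ ^ 2 ∂mu := by
  rw [← inner_self_eq_norm_sq (𝕜 := ℂ), L2.inner_def, ← integral_re (L2.integrable_inner _ _)]
  refine integral_congr_ae ?_
  filter_upwards [coeFn_toH hF] with t h
  rw [h, inner_self_eq_norm_sq]

theorem norm_mulOp_le (V : LInfty) (f : H) : ‖mulOp V f‖ ≤ ‖V‖ * ‖f‖ := Lp.norm_smul_le V f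

/-- Test functions with boundary values `ρ` and `1` whose `L²` norms tend to zero isolate the
boundary term `Im ⟨f, i f'⟩ = (1 - |ρ|²)/2`: the contributions of `V` and `k` vanish in the limit.
-/
theorem norm_boundary_le_one {V : LInfty} {ρ : ℂ} {k : H} (hA : IsDissipative (opA V ρ k)) :
    ‖ρ‖ ≤ 1 := by
  set L := 2 * Real.pi with hL
  have hLpos : 0 < L := two_pi_pos
  let F : ℕ → ℝ → ℂ := fun n x => (((x / L) ^ (n + 1) : ℝ) : ℂ) + ρ * (((1 - x / L) ^ (n + 1) : ℝ) : ℂ)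
  let F' : ℕ → ℝ → ℂ := fun n x => (((n + 1 : ℝ) * (x / L) ^ n * (1 / L) : ℝ) : ℂ) +
    ρ * (((n + 1 : ℝ) * (1 - x / L) ^ n * (-(1 / L)) : ℝ) : ℂ)
  have hF : ∀ n x, HasDerivAt (F n) (F' n x) x := by
    intro n x
    have h1 : HasDerivAt (fun x : ℝ => x / L) (1 / L) x := (hasDerivAt_id x).div_const L
    have h2 : HasDerivAt (fun x : ℝ => (x / L) ^ (n + 1)) ((n + 1 : ℝ) * (x / L) ^ n * (1 / L)) x := by
      simpa using h1.fun_pow (n + 1)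
    have h3 : HasDerivAt (fun x : ℝ => (1 - x / L) ^ (n + 1))
        ((n + 1 : ℝ) * (1 - x / L) ^ n * (-(1 / L))) x := by
      simpa using (h1.const_sub 1).fun_pow (n + 1)
    exact h2.ofReal_comp.add (h3.ofReal_comp.const_mul ρ)
  have hFc : ∀ n, Continuous (F n) := fun n => by fun_prop
  have hF'c : ∀ n, Continuous (F' n) := fun n => by fun_prop
  let f : ℕ → H := fun n => toH (F n) (hFc n).continuousOn
  have hF0 : ∀ n, F n 0 = ρ := fun n => by simp [F]
  have hF1 : ∀ n, F n L = 1 := fun n => by simp [F, hLpos.ne']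
  have hineq : ∀ n, 0 ≤ (1 - ‖ρ‖ ^ 2) / 2 + ‖V‖ * ‖f n‖ ^ 2 + ‖k‖ * ‖f n‖ := by
    intro n
    obtain ⟨hd, h⟩ := mem_domain_opA (V := V) (ρ := ρ) (k := k)
      (isACRep_of_hasDerivAt (hF n) (hFc n) (hF'c n)) (by rw [hF0, hF1, mul_one])
    have h1 := hA.2 ⟨_, hd⟩
    rw [h, hF1, one_smul, inner_add_right, inner_add_right, inner_smul_right] at h1
    have h2 := re_inner_deriv (hF n) (hFc n) (hF'c n)
    rw [hF0, hF1, norm_one, one_pow] at h2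
    have h3 : (inner ℂ (f n) (mulOp V (f n))).im ≤ ‖V‖ * ‖f n‖ ^ 2 := by
      refine (Complex.im_le_norm _).trans ((norm_inner_le_norm _ _).trans ?_)
      nlinarith [norm_mulOp_le V (f n), norm_nonneg (f n)]
    have h4 : (inner ℂ (f n) k).im ≤ ‖k‖ * ‖f n‖ :=
      (Complex.im_le_norm _).trans ((norm_inner_le_norm _ _).trans_eq (mul_comm _ _))
    simp only [Complex.add_im, Complex.I_mul_im] at h1
    rw [h2] at h1
    change 0 ≤ _ + (inner ℂ (f n) (mulOp V (f n))).im + (inner ℂ (f n) k).im at h1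
    linarith
  have hlim2 : Tendsto (fun n => ‖f n‖ ^ 2) atTop (𝓝 0) := by
    have h1 : ∀ n, ‖f n‖ ^ 2 = ∫ t, ‖F n t‖ ^ 2 ∂mu := fun n => norm_sq_toH _
    simp_rw [h1]
    rw [show (0 : ℝ) = ∫ t, (0 : ℝ) ∂mu by simp]
    refine tendsto_integral_of_dominated_convergence (fun _ => (1 + ‖ρ‖) ^ 2)
      (fun n => ((hFc n).norm.pow 2).aestronglyMeasurable) (integrable_const _) ?_ ?_
    · intro n
      rw [ae_restrict_iff' measurableSet_Ioo]
      refine Eventually.of_forall fun x hx => ?_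
      have hx0 : 0 ≤ x / L := div_nonneg hx.1.le hLpos.le
      have hx1 : x / L ≤ 1 := (div_le_one hLpos).2 hx.2.le
      rw [Real.norm_of_nonneg (by positivity)]
      gcongr
      refine (norm_add_le _ _).trans ?_
      rw [norm_mul, Complex.norm_real, Complex.norm_real, Real.norm_of_nonneg (by positivity),
        Real.norm_of_nonneg (pow_nonneg (by linarith) _)]
      have h2 : (x / L) ^ (n + 1) ≤ 1 := pow_le_one₀ hx0 hx1
      have h3 : (1 - x / L) ^ (n + 1) ≤ 1 := pow_le_one₀ (by linarith) (by linarith)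
      nlinarith [norm_nonneg ρ]
    · rw [ae_restrict_iff' measurableSet_Ioo]
      refine Eventually.of_forall fun x hx => ?_
      have hx0 : 0 < x / L := div_pos hx.1 hLpos
      have hx1 : x / L < 1 := (div_lt_one hLpos).2 hx.2
      have h2 : Tendsto (fun n : ℕ => (x / L) ^ (n + 1)) atTop (𝓝 0) :=
        (tendsto_pow_atTop_nhds_zero_of_lt_one hx0.le hx1).comp (tendsto_add_atTop_nat 1)
      have h3 : Tendsto (fun n : ℕ => (1 - x / L) ^ (n + 1)) atTop (𝓝 0) :=
        (tendsto_pow_atTop_nhds_zero_of_lt_one (by linarith) (by linarith)).comp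
          (tendsto_add_atTop_nat 1)
      have h4 : Tendsto (fun n => F n x) atTop (𝓝 (((0 : ℝ) : ℂ) + ρ * ((0 : ℝ) : ℂ))) :=
        ((Complex.continuous_ofReal.tendsto _).comp h2).add
          (((Complex.continuous_ofReal.tendsto _).comp h3).const_mul ρ)
      simpa using (h4.norm.pow 2)
  have hlim1 : Tendsto (fun n => ‖f n‖) atTop (𝓝 0) := by
    have := (Real.continuous_sqrt.tendsto 0).comp hlim2
    simpa [Function.comp_def, Real.sqrt_sq] using this
  have hlim : Tendsto (fun n => (1 - ‖ρ‖ ^ 2) / 2 + ‖V‖ * ‖f n‖ ^ 2 + ‖k‖ * ‖f n‖) atTop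
      (𝓝 ((1 - ‖ρ‖ ^ 2) / 2 + ‖V‖ * 0 + ‖k‖ * 0)) :=
    (tendsto_const_nhds.add (hlim2.const_mul _)).add (hlim1.const_mul _)
  have h5 := ge_of_tendsto' hlim hineq
  have h6 : ‖ρ‖ ^ 2 ≤ 1 := by linarith
  exact (sq_le_one_iff₀ (norm_nonneg ρ)).1 h6

end BoundaryParameter

/-! ### The Fourier basis -/

section Fourier

/-- The normalized exponential `e^{-inx} / √(2π)`. -/
def expFun (n : ℤ) (x : ℝ) : ℂ :=
  ((√(2 * Real.pi))⁻¹ : ℝ) * Complex.exp (-(Complex.I * n * x))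

theorem continuous_expFun (n : ℤ) : Continuous (expFun n) := by
  unfold expFun; fun_prop

theorem conj_expFun (n : ℤ) (x : ℝ) : (starRingEnd ℂ) (expFun n x) =
    ((√(2 * Real.pi))⁻¹ : ℝ) * Complex.exp (Complex.I * n * x) := by
  rw [expFun, map_mul, Complex.conj_ofReal, ← Complex.exp_conj]
  simp

/-- The normalized exponential in `L²(0, 2π)`. -/
def expH (n : ℤ) : H := toH (expFun n) (continuous_expFun n).continuousOn

theorem inner_expH (n : ℤ) (f : H) : inner ℂ (expH n) f =
    ((√(2 * Real.pi))⁻¹ : ℝ) * ∫ t in (0 : ℝ)..(2 * Real.pi), Complex.exp (Complex.I * n * t) * f t := by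
  rw [L2.inner_def, intervalIntegral.integral_of_le two_pi_pos.le, integral_Ioc_eq_integral_Ioo,
    ← integral_const_mul]
  refine integral_congr_ae ?_
  filter_upwards [coeFn_toH (continuous_expFun n).continuousOn] with t h
  rw [expH, h, RCLike.inner_apply, conj_expFun]
  ring

theorem inv_sqrt_two_pi_sq : ((√(2 * Real.pi))⁻¹) ^ 2 = (2 * Real.pi)⁻¹ := by
  rw [inv_pow, Real.sq_sqrt two_pi_pos.le]

theorem orthonormal_expH : Orthonormal ℂ expH := by
  rw [orthonormal_iff_ite]
  intro n m
  have h1 : ∫ t in (0 : ℝ)..(2 * Real.pi), Complex.exp (Complex.I * n * t) * expH m t =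
      ∫ t in (0 : ℝ)..(2 * Real.pi), ((√(2 * Real.pi))⁻¹ : ℝ) *
        Complex.exp (Complex.I * (n - m) * t) := by
    refine integral_congr_coe ?_ (right_mem_Icc.2 two_pi_pos.le)
    filter_upwards [coeFn_toH (continuous_expFun m).continuousOn] with t h
    rw [expH, h, expFun, mul_left_comm, ← Complex.exp_add]
    congr 2; ring
  rw [inner_expH, h1, intervalIntegral.integral_const_mul, ← mul_assoc, ← Complex.ofReal_mul,
    ← sq, inv_sqrt_two_pi_sq]
  split_ifs with hnm
  · subst hnm
    have hpi : (Real.pi : ℂ) ≠ 0 := by exact_mod_cast Real.pi_ne_zero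
    simp
    field_simp
  · have hc : Complex.I * ((n : ℂ) - m) ≠ 0 :=
      mul_ne_zero Complex.I_ne_zero (sub_ne_zero.2 (by exact_mod_cast hnm))
    rw [integral_exp_mul_complex hc]
    have : Complex.exp (Complex.I * ((n : ℂ) - m) * ((2 * Real.pi : ℝ) : ℂ)) = 1 := by
      rw [Complex.exp_eq_one_iff]
      exact ⟨n - m, by push_cast; ring⟩
    rw [this]; simp

theorem eq_zero_of_inner_expH (f : H) (hf : ∀ n, inner ℂ (expH n) f = 0) : f = 0 := by
  have hL2 : MemLp f 2 (volume.restrict (Ioc 0 (2 * Real.pi))) := by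
    rw [← restrict_Ioo_eq_restrict_Ioc]; exact Lp.memLp f
  have h1 := hasSum_sq_fourierCoeffOn two_pi_pos hL2
  have h2 : ∀ n, fourierCoeffOn two_pi_pos f n = 0 := by
    intro n
    -- The sign changes because `expFun n` carries `e^{-inx}`, opposite to the Fourier convention of
    -- `fourierCoeffOn`.
    have h3 := hf (-n)
    rw [inner_expH, mul_eq_zero] at h3
    have h4 := h3.resolve_left 
      (Complex.ofReal_ne_zero.2 (inv_ne_zero (Real.sqrt_ne_zero'.2 two_pi_pos)))
    rw [fourierCoeffOn_eq_integral]
    refine smul_eq_zero_of_right _ ?_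
    rw [← h4]
    refine intervalIntegral.integral_congr fun t _ => ?_
    simp only [fourier_coe_apply, smul_eq_mul]
    congr 2
    push_cast
    have := Real.pi_ne_zero
    have : (Real.pi : ℂ) ≠ 0 := by exact_mod_cast this
    field_simp
    ring
  simp only [h2, norm_zero, ne_eq, OfNat.ofNat_ne_zero, not_false_eq_true, zero_pow] at h1
  have h3 := h1.unique hasSum_zero
  rw [smul_eq_zero] at h3
  have h4 := h3.resolve_left (inv_ne_zero (by simp))
  rw [intervalIntegral.integral_of_le two_pi_pos.le, integral_Ioc_eq_integral_Ioo] at h4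
  have h5 : ‖f‖ ^ 2 = 0 := by
    rw [← inner_self_eq_norm_sq (𝕜 := ℂ), L2.inner_def, ← integral_re (L2.integrable_inner _ _),
      ← h4]
    refine integral_congr_ae (Eventually.of_forall fun t => ?_)
    exact inner_self_eq_norm_sq (𝕜 := ℂ) (f t)
  exact norm_eq_zero.1 (pow_eq_zero_iff two_ne_zero |>.1 h5)

/-- The Fourier basis of `L²(0, 2π)`. -/
def expBasis : HilbertBasis ℤ ℂ H :=
  HilbertBasis.mkOfOrthogonalEqBot orthonormal_expH (by
    rw [eq_bot_iff]
    intro f hf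
    refine eq_zero_of_inner_expH f fun n => ?_
    exact (Submodule.mem_orthogonal _ _).1 hf _ (Submodule.subset_span ⟨n, rfl⟩))

theorem expBasis_apply (n : ℤ) : expBasis n = expH n := by
  rw [expBasis, HilbertBasis.coe_mkOfOrthogonalEqBot]

/-- The truncated Fourier coefficients `∫_0^x e^{int} q(t) dt`. -/
def partialCoeff (q : ℝ → ℂ) (n : ℤ) (x : ℝ) : ℂ :=
  ∫ t in (0 : ℝ)..x, Complex.exp (Complex.I * n * t) * q t

/-- Bessel's inequality for `q` cut off at `x`. The bound does not depend on `x`, so it can be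
integrated over `x`. -/
theorem sum_norm_sq_partialCoeff_le (q : H) {x : ℝ} (hx : x ∈ Icc 0 (2 * Real.pi))
    (s : Finset ℤ) : ∑ n ∈ s, ‖partialCoeff q n x‖ ^ 2 ≤ 2 * Real.pi * ‖q‖ ^ 2 := by
  have hm : MemLp ((Ioc 0 x).indicator q) 2 mu := (Lp.memLp q).indicator measurableSet_Ioc
  set f : H := hm.toLp _ with hf
  have hfq : f =ᵐ[mu] (Ioc 0 x).indicator q := hm.coeFn_toLp
  have h1 : ∀ n, partialCoeff q n x =
      ∫ t in (0 : ℝ)..(2 * Real.pi), Complex.exp (Complex.I * n * t) * f t := by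
    intro n
    have h2 : ∫ t in (0 : ℝ)..(2 * Real.pi), Complex.exp (Complex.I * n * t) * f t =
        ∫ t in (0 : ℝ)..(2 * Real.pi),
          (Ioc 0 x).indicator (fun t => Complex.exp (Complex.I * n * t) * q t) t := by
      refine integral_congr_coe ?_ (right_mem_Icc.2 two_pi_pos.le)
      filter_upwards [hfq] with t h
      rw [h]
      by_cases ht : t ∈ Ioc 0 x <;> simp [ht]
    rw [h2, partialCoeff, intervalIntegral.integral_of_le two_pi_pos.le,
      intervalIntegral.integral_of_le hx.1, setIntegral_indicator measurableSet_Ioc,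
      inter_eq_self_of_subset_right (Ioc_subset_Ioc_right hx.2)]
  have h3 : ‖f‖ ≤ ‖q‖ := by
    refine Lp.norm_le_norm_of_ae_le ?_
    filter_upwards [hfq] with t h
    rw [h]
    exact norm_indicator_le_norm_self _ _
  have h4 := orthonormal_expH.sum_inner_products_le f (s := s)
  have h5 : ∀ n, ‖inner ℂ (expH n) f‖ ^ 2 = (2 * Real.pi)⁻¹ * ‖partialCoeff q n x‖ ^ 2 := by
    intro n
    rw [inner_expH, ← h1, norm_mul, mul_pow, Complex.norm_real,
      Real.norm_of_nonneg (inv_nonneg.2 (Real.sqrt_nonneg _)), inv_sqrt_two_pi_sq]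
  simp_rw [h5] at h4
  rw [← Finset.mul_sum, inv_mul_le_iff₀ two_pi_pos] at h4
  refine h4.trans ?_
  gcongr

theorem summable_norm_sq_coeff (q : H) :
    Summable fun n => ‖partialCoeff q n (2 * Real.pi)‖ ^ 2 :=
  summable_of_sum_le (fun _ => by positivity)
    (sum_norm_sq_partialCoeff_le q (right_mem_Icc.2 two_pi_pos.le))

theorem tendsto_coeff (q : H) :
    Tendsto (fun n => ‖partialCoeff q n (2 * Real.pi)‖) cofinite (𝓝 0) := by
  have h := (summable_norm_sq_coeff q).tendsto_cofinite_zero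
  have := (Real.continuous_sqrt.tendsto 0).comp h
  simpa [Function.comp_def, Real.sqrt_sq] using this

theorem continuousOn_partialCoeff (q : H) (n : ℤ) :
    ContinuousOn (partialCoeff q n) (Icc 0 (2 * Real.pi)) := by
  have hg : IntervalIntegrable (fun t => Complex.exp (Complex.I * n * t) * q t) volume 0
      (2 * Real.pi) := (intervalIntegrable_coe q (right_mem_Icc.2 two_pi_pos.le)).continuousOn_mul
        (Continuous.continuousOn (by fun_prop))
  have := (absolutelyContinuous_integral hg).continuousOn
  rwa [uIcc_of_le two_pi_pos.le] at this

theorem summable_integral_partialCoeff (q : H) :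
    Summable fun n => ∫ x, ‖partialCoeff q n x‖ ^ 2 ∂mu := by
  have hi : ∀ n, Integrable (fun x => ‖partialCoeff q n x‖ ^ 2) mu := by
    intro n
    have h1 := memLp_of_continuousOn (continuousOn_partialCoeff q n)
    exact (memLp_two_iff_integrable_sq_norm h1.1).1 h1
  refine summable_of_sum_le (c := ∫ x, 2 * Real.pi * ‖q‖ ^ 2 ∂mu)
    (fun n => integral_nonneg fun x => by positivity) fun s => ?_
  rw [← integral_finsetSum _ fun n _ => hi n]
  refine integral_mono_ae (integrable_finsetSum _ fun n _ => hi n) (integrable_const _) ?_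
  rw [EventuallyLE, ae_restrict_iff' measurableSet_Ioo]
  exact Eventually.of_forall fun x hx => sum_norm_sq_partialCoeff_le q (Ioo_subset_Icc_self hx) s

end Fourier

/-! ### Asymptotics of the eigenvalues -/

section Eigenvalues

theorem exists_fixedPoint_closedBall {Ψ : ℂ → ℂ}
    (hΨ : ∀ x ∈ Metric.closedBall (0 : ℂ) (2 * ‖Ψ 0‖), ∀ y ∈ Metric.closedBall (0 : ℂ) (2 * ‖Ψ 0‖),
      ‖Ψ x - Ψ y‖ ≤ 1 / 2 * ‖x - y‖) :
    ∃ x, ‖x‖ ≤ 2 * ‖Ψ 0‖ ∧ Ψ x = x := by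
  set s := Metric.closedBall (0 : ℂ) (2 * ‖Ψ 0‖) with hs
  have h0 : (0 : ℂ) ∈ s := by simp [hs]
  have hmaps : MapsTo Ψ s s := by
    intro x hx
    have h1 := hΨ x hx 0 h0
    rw [sub_zero] at h1
    have hx' : ‖x‖ ≤ 2 * ‖Ψ 0‖ := by simpa [hs] using hx
    have h2 : ‖Ψ x‖ ≤ ‖Ψ x - Ψ 0‖ + ‖Ψ 0‖ := by
      simpa using norm_add_le (Ψ x - Ψ 0) (Ψ 0)
    rw [hs, mem_closedBall_zero_iff]
    linarith
  have hc : ContractingWith (1 / 2) (hmaps.restrict Ψ s s) := by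
    refine ⟨by rw [← NNReal.coe_lt_coe]; norm_num, LipschitzWith.of_dist_le_mul fun x y => ?_⟩
    rw [Subtype.dist_eq, Subtype.dist_eq, dist_eq_norm, dist_eq_norm]
    simpa using hΨ x x.2 y y.2
  obtain ⟨x, hx, hfx, -⟩ := hc.exists_fixedPoint' Metric.isClosed_closedBall.isComplete hmaps h0
    (edist_ne_top _ _)
  exact ⟨x, by simpa [hs] using hx, hfx⟩

theorem norm_exp_sub_self_sub_le {w w' : ℂ} {r : ℝ} (hr : r ≤ 1) (hw : ‖w‖ ≤ r) (hw' : ‖w'‖ ≤ r) :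
    ‖(Complex.exp w - w) - (Complex.exp w' - w')‖ ≤ 2 * r * ‖w - w'‖ := by
  refine (convex_closedBall (0 : ℂ) r).norm_image_sub_le_of_norm_hasDerivWithin_le
    (f := fun w => Complex.exp w - w) (f' := fun w => Complex.exp w - 1)
    (fun x _ => ((Complex.hasDerivAt_exp x).sub (hasDerivAt_id x)).hasDerivWithinAt) (fun x hx => ?_)
    (by simpa using hw') (by simpa using hw)
  have hx' : ‖x‖ ≤ r := by simpa using hx
  refine (Complex.norm_exp_sub_one_le (hx'.trans hr)).trans ?_
  linarith

/-- The `L¹` norm of a class in `L²(0, 2π)`. -/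
def norm1 (q : H) : ℝ := ∫ t in (0 : ℝ)..(2 * Real.pi), ‖q t‖

theorem norm1_nonneg (q : H) : 0 ≤ norm1 q :=
  intervalIntegral.integral_nonneg two_pi_pos.le fun _ _ => norm_nonneg _

theorem norm_integral_mul_le (q : H) {φ : ℝ → ℂ} {B x : ℝ} (hx : x ∈ Icc 0 (2 * Real.pi))
    (hB : ∀ t ∈ Icc 0 (2 * Real.pi), ‖φ t‖ ≤ B) :
    ‖∫ t in (0 : ℝ)..x, φ t * q t‖ ≤ B * norm1 q := by
  have hr := right_mem_Icc.2 two_pi_pos.le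
  have hB0 : 0 ≤ B := (norm_nonneg _).trans (hB _ hr)
  have hi := (intervalIntegrable_coe q hr).norm.const_mul B
  calc ‖∫ t in (0 : ℝ)..x, φ t * q t‖ ≤ ∫ t in (0 : ℝ)..x, B * ‖q t‖ := by
        refine intervalIntegral.norm_integral_le_of_norm_le hx.1 (Eventually.of_forall ?_)
          ((intervalIntegrable_coe q hx).norm.const_mul B)
        intro t ht
        rw [norm_mul]
        gcongr
        exact hB t ⟨ht.1.le, ht.2.trans hx.2⟩
    _ ≤ ∫ t in (0 : ℝ)..(2 * Real.pi), B * ‖q t‖ := by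
        refine intervalIntegral.integral_mono_interval le_rfl hx.1 hx.2
          (Eventually.of_forall fun t => by positivity) hi
    _ = B * norm1 q := intervalIntegral.integral_const_mul _ _

theorem norm_exp_I_int (n : ℤ) (t : ℝ) : ‖Complex.exp (Complex.I * n * t)‖ = 1 := by
  rw [Complex.norm_exp]; simp

theorem intervalIntegrable_mul (q : H) {φ : ℝ → ℂ} (hφ : Continuous φ) {x : ℝ}
    (hx : x ∈ Icc 0 (2 * Real.pi)) : IntervalIntegrable (fun t => φ t * q t) volume 0 x :=
  (intervalIntegrable_coe q hx).continuousOn_mul hφ.continuousOn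

theorem abs_le_two_pi {t : ℝ} (ht : t ∈ Icc 0 (2 * Real.pi)) : ‖(t : ℂ)‖ ≤ 2 * Real.pi := by
  rw [Complex.norm_real, Real.norm_of_nonneg ht.1]; exact ht.2

/-- The class of `t q(t)` in `L²(0, 2π)`. -/
theorem exists_id_mul (q : H) : ∃ q₁ : H, q₁ =ᵐ[mu] fun t : ℝ => (t : ℂ) * q t := by
  have hm : MemLp (fun t : ℝ => (t : ℂ) * q t) 2 mu := by
    refine MemLp.of_le_mul (c := 2 * Real.pi) (Lp.memLp q) ?_ ?_
    · exact (Complex.continuous_ofReal.aestronglyMeasurable).mul (Lp.aestronglyMeasurable q)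
    · rw [ae_restrict_iff' measurableSet_Ioo]
      refine Eventually.of_forall fun t ht => ?_
      rw [norm_mul]
      gcongr
      exact abs_le_two_pi (Ioo_subset_Icc_self ht)
  exact ⟨hm.toLp _, hm.coeFn_toLp⟩

theorem norm_I_mul_le {e : ℂ} {δ : ℝ} (he : ‖e‖ ≤ δ) {t : ℝ} (ht : t ∈ Icc 0 (2 * Real.pi)) :
    ‖Complex.I * e * t‖ ≤ 2 * Real.pi * δ := by
  rw [norm_mul, norm_mul, Complex.norm_I, one_mul, mul_comm]
  exact mul_le_mul (abs_le_two_pi ht) he (norm_nonneg _) two_pi_pos.le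

/-- The shifted eigenvalue equation `e^{2πiε} - 1 = i ∫ e^{int} e^{iεt} q(t) dt` has, for all but
finitely many `n`, a solution dominated by a Fourier coefficient of `q`. -/
theorem exists_shifts (q : H) : ∃ (F : Finset ℤ) (ε : ℤ → ℂ),
    (∀ n, ‖ε n‖ ≤ ‖partialCoeff q n (2 * Real.pi)‖) ∧ (∀ n, ‖ε n‖ ≤ (16 * Real.pi)⁻¹) ∧
    ∀ n ∉ F, Complex.exp (2 * Real.pi * Complex.I * ε n) - 1 = Complex.I *
      ∫ t in (0 : ℝ)..(2 * Real.pi),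
        Complex.exp (Complex.I * n * t) * Complex.exp (Complex.I * ε n * t) * q t := by
  have hpi := Real.pi_pos
  have hpi3 := Real.pi_gt_three
  have hr := right_mem_Icc.2 two_pi_pos.le
  obtain ⟨q₁, hq₁⟩ := exists_id_mul q
  -- With this choice `8π²δ(1 + ‖q‖₁) = π/2`, and the Lipschitz constant of the map `Ψ` below is at
  -- most `(π/2 + 1)/(2π) ≤ 1/2`.
  set δ : ℝ := (16 * Real.pi * (1 + norm1 q))⁻¹ with hδ
  have hq0 := norm1_nonneg q
  have hδ0 : 0 < δ := by positivity
  have hδ1 : δ ≤ (16 * Real.pi)⁻¹ := by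
    rw [hδ]
    exact inv_anti₀ (by positivity) (le_mul_of_one_le_right (by positivity) (by linarith))
  have hδ2 : δ * (1 + norm1 q) = (16 * Real.pi)⁻¹ := by rw [hδ]; field_simp
  have hδ3 : 2 * Real.pi * δ ≤ 1 := by
    calc 2 * Real.pi * δ ≤ 2 * Real.pi * (16 * Real.pi)⁻¹ := by gcongr
      _ = 1 / 8 := by field_simp; norm_num
      _ ≤ 1 := by norm_num
  have hfin1 : {n | ¬ ‖partialCoeff q n (2 * Real.pi)‖ < δ}.Finite :=
    (tendsto_coeff q).eventually_lt_const hδ0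
  have hfin2 : {n | ¬ ‖partialCoeff q₁ n (2 * Real.pi)‖ < 1}.Finite :=
    (tendsto_coeff q₁).eventually_lt_const one_pos
  have hkey : ∀ n : ℤ, ‖partialCoeff q n (2 * Real.pi)‖ < δ →
      ‖partialCoeff q₁ n (2 * Real.pi)‖ < 1 → ∃ e : ℂ,
      ‖e‖ ≤ ‖partialCoeff q n (2 * Real.pi)‖ ∧
      Complex.exp (2 * Real.pi * Complex.I * e) - 1 = Complex.I *
      ∫ t in (0 : ℝ)..(2 * Real.pi),
        Complex.exp (Complex.I * n * t) * Complex.exp (Complex.I * e * t) * q t := by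
    intro n h1 h2
    let J : ℂ → ℂ := fun e => ∫ t in (0 : ℝ)..(2 * Real.pi),
        Complex.exp (Complex.I * n * t) * Complex.exp (Complex.I * e * t) * q t
    have hc : (2 * Real.pi * Complex.I : ℂ) ≠ 0 := Complex.two_pi_I_ne_zero
    have hcn : ‖(2 * Real.pi * Complex.I : ℂ)‖ = 2 * Real.pi := by
      simp [abs_of_pos hpi]
    -- A simplified Newton map: `2πi` is the derivative of `e^{2πie}` at `0`, and fixed points are
    -- the solutions sought.
    let Ψ : ℂ → ℂ := fun e => e - (2 * Real.pi * Complex.I)⁻¹ *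
      (Complex.exp (2 * Real.pi * Complex.I * e) - 1 - Complex.I * J e)
    have hJ0 : J 0 = partialCoeff q n (2 * Real.pi) := by
      simp [J, partialCoeff]
    have hΨ0 : ‖Ψ 0‖ = (2 * Real.pi)⁻¹ * ‖partialCoeff q n (2 * Real.pi)‖ := by
      have : Ψ 0 = (2 * Real.pi * Complex.I)⁻¹ * (Complex.I * partialCoeff q n (2 * Real.pi)) := by
        simp only [Ψ, hJ0]; simp
      rw [this, norm_mul, norm_mul, norm_inv, hcn, Complex.norm_I, one_mul]
    have hr0 : 2 * ‖Ψ 0‖ ≤ ‖partialCoeff q n (2 * Real.pi)‖ := by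
      rw [hΨ0, ← mul_assoc]
      refine mul_le_of_le_one_left (norm_nonneg _) ?_
      rw [mul_inv_le_iff₀ two_pi_pos]; linarith
    have hLip : ∀ x y : ℂ, ‖x‖ ≤ δ → ‖y‖ ≤ δ → ‖Ψ x - Ψ y‖ ≤ 1 / 2 * ‖x - y‖ := by
      intro x y hx hy
      -- The linear part in the shift is split off. Its coefficient is a Fourier coefficient of `t
      -- q(t)`, small for large `|n|`; the remainder has a factor `δ`.
      have hJd : J x - J y = (∫ t in (0 : ℝ)..(2 * Real.pi), (Complex.exp (Complex.I * n * t) *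
            ((Complex.exp (Complex.I * x * t) - Complex.I * x * t) -
              (Complex.exp (Complex.I * y * t) - Complex.I * y * t))) * q t) +
          Complex.I * (x - y) * partialCoeff q₁ n (2 * Real.pi) := by
        have h3 : partialCoeff q₁ n (2 * Real.pi) =
            ∫ t in (0 : ℝ)..(2 * Real.pi), (Complex.exp (Complex.I * n * t) * t) * q t := by
          refine integral_congr_coe ?_ hr
          filter_upwards [hq₁] with t ht
          rw [ht]; ring
        rw [h3, ← intervalIntegral.integral_const_mul,
          ← intervalIntegral.integral_sub (intervalIntegrable_mul q (by fun_prop) hr)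
            (intervalIntegrable_mul q (by fun_prop) hr),
          ← intervalIntegral.integral_add (intervalIntegrable_mul q (by fun_prop) hr)
            ((intervalIntegrable_mul q (by fun_prop) hr).const_mul _)]
        refine intervalIntegral.integral_congr fun t _ => ?_
        ring
      have hJn : ‖J x - J y‖ ≤ 2 * (2 * Real.pi * δ) * (2 * Real.pi * ‖x - y‖) * norm1 q +
          ‖x - y‖ := by
        rw [hJd]
        refine (norm_add_le _ _).trans (add_le_add (norm_integral_mul_le q hr fun t ht => ?_) ?_)
        · rw [norm_mul, norm_exp_I_int, one_mul]
          refine (norm_exp_sub_self_sub_le hδ3 (norm_I_mul_le hx ht) (norm_I_mul_le hy ht)).trans ?_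
          have h4 : Complex.I * x * t - Complex.I * y * t = Complex.I * (x - y) * t := by ring
          rw [h4]
          have := norm_I_mul_le (le_refl ‖x - y‖) ht
          gcongr
        · rw [norm_mul, norm_mul, Complex.norm_I, one_mul]
          exact mul_le_of_le_one_right (norm_nonneg _) h2.le
      have hEn : ‖(Complex.exp (2 * Real.pi * Complex.I * x) - 2 * Real.pi * Complex.I * x) -
          (Complex.exp (2 * Real.pi * Complex.I * y) - 2 * Real.pi * Complex.I * y)‖ ≤
          2 * (2 * Real.pi * δ) * (2 * Real.pi * ‖x - y‖) := by
        have h5 : ∀ e : ℂ, ‖e‖ ≤ δ → ‖2 * Real.pi * Complex.I * e‖ ≤ 2 * Real.pi * δ := by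
          intro e he
          rw [norm_mul, hcn]; gcongr
        refine (norm_exp_sub_self_sub_le hδ3 (h5 x hx) (h5 y hy)).trans ?_
        rw [← mul_sub, norm_mul, hcn]
      have hΨd : Ψ x - Ψ y = (2 * Real.pi * Complex.I)⁻¹ * (Complex.I * (J x - J y) -
          ((Complex.exp (2 * Real.pi * Complex.I * x) - 2 * Real.pi * Complex.I * x) -
          (Complex.exp (2 * Real.pi * Complex.I * y) - 2 * Real.pi * Complex.I * y))) := by
        simp only [Ψ]
        field_simp
        ring
      rw [hΨd, norm_mul, norm_inv, hcn, inv_mul_le_iff₀ two_pi_pos]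
      refine (norm_sub_le _ _).trans ?_
      rw [norm_mul, Complex.norm_I, one_mul]
      have h6 : 2 * (2 * Real.pi * δ) * (2 * Real.pi * ‖x - y‖) * norm1 q + ‖x - y‖ +
          2 * (2 * Real.pi * δ) * (2 * Real.pi * ‖x - y‖) =
          (8 * Real.pi ^ 2 * (δ * (1 + norm1 q)) + 1) * ‖x - y‖ := by ring
      have h7 : 8 * Real.pi ^ 2 * (δ * (1 + norm1 q)) = Real.pi / 2 := by
        rw [hδ2]; field_simp; norm_num
      rw [h7] at h6
      have h8 : (Real.pi / 2 + 1) * ‖x - y‖ ≤ Real.pi * ‖x - y‖ := by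
        gcongr; linarith
      linarith
    obtain ⟨e, he, hfix⟩ := exists_fixedPoint_closedBall (Ψ := Ψ) fun x hx y hy =>
      hLip x y (((mem_closedBall_zero_iff.1 hx).trans hr0).trans h1.le)
        (((mem_closedBall_zero_iff.1 hy).trans hr0).trans h1.le)
    refine ⟨e, he.trans hr0, ?_⟩
    have h9 : (2 * Real.pi * Complex.I : ℂ)⁻¹ *
      (Complex.exp (2 * Real.pi * Complex.I * e) - 1 - Complex.I * J e) = 0 := by
      have := hfix
      simp only [Ψ] at this
      exact sub_eq_self.1 this
    exact sub_eq_zero.1 ((mul_eq_zero.1 h9).resolve_left (inv_ne_zero hc))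
  choose! e he1 he2 using hkey
  classical
  let F := hfin1.toFinset ∪ hfin2.toFinset
  have hF : ∀ n ∉ F, ‖partialCoeff q n (2 * Real.pi)‖ < δ ∧
      ‖partialCoeff q₁ n (2 * Real.pi)‖ < 1 := by
    intro n hn
    simpa [F, not_or] using hn
  -- The value `0` on `F` makes the two bounds hold for all `n`, while the equation is needed only
  -- off `F`.
  refine ⟨F, fun n => if n ∈ F then 0 else e n, fun n => ?_, fun n => ?_, fun n hn => ?_⟩
  · by_cases hn : n ∈ F
    · simp [hn]
    · simp only [if_neg hn]; exact he1 n (hF n hn).1 (hF n hn).2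
  · by_cases hn : n ∈ F
    · simp only [if_pos hn, norm_zero]; positivity
    · simp only [if_neg hn]; exact ((he1 n (hF n hn).1 (hF n hn).2).trans (hF n hn).1.le).trans hδ1
  · simp only [if_neg hn]
    exact he2 n (hF n hn).1 (hF n hn).2

end Eigenvalues

/-! ### Asymptotics of the eigenfunctions -/

section ModelEigenfunctions

/-- The eigenfunctions after a gauge transformation removing the potential. -/
def modelFun (q : ℝ → ℂ) (w : ℂ) (x : ℝ) : ℂ :=
  Complex.exp (-(Complex.I * w * x)) *
    (1 + Complex.I * ∫ t in (0 : ℝ)..x, Complex.exp (Complex.I * w * t) * q t)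

theorem continuousOn_modelFun (q : H) (w : ℂ) :
    ContinuousOn (modelFun q w) (Icc 0 (2 * Real.pi)) := by
  have hg := intervalIntegrable_mul q (φ := fun t => Complex.exp (Complex.I * w * t))
    (by fun_prop) (right_mem_Icc.2 two_pi_pos.le)
  have h1 := (absolutelyContinuous_integral hg).continuousOn
  rw [uIcc_of_le two_pi_pos.le] at h1
  exact (Continuous.continuousOn (by fun_prop)).mul
    (continuousOn_const.add (continuousOn_const.mul h1))

theorem norm_exp_shift_sub_one_le {e : ℂ} (he : ‖e‖ ≤ (16 * Real.pi)⁻¹) {t : ℝ}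
    (ht : t ∈ Icc 0 (2 * Real.pi)) :
    ‖Complex.exp (Complex.I * e * t) - 1‖ ≤ 4 * Real.pi * ‖e‖ := by
  have h1 := norm_I_mul_le (le_refl ‖e‖) ht
  have h2 : 2 * Real.pi * ‖e‖ ≤ 1 := by
    calc 2 * Real.pi * ‖e‖ ≤ 2 * Real.pi * (16 * Real.pi)⁻¹ := by gcongr
      _ = 1 / 8 := by have := Real.pi_pos; field_simp; norm_num
      _ ≤ 1 := by norm_num
  refine (Complex.norm_exp_sub_one_le (h1.trans h2)).trans ?_
  linarith

/-- Factoring out `e^{-inx}` leaves the shift error and a truncated Fourier integral. Both are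
square summable over `n`, the second after integration in `x`. -/
theorem norm_modelFun_sub_le (q : H) (n : ℤ) {e : ℂ} (he : ‖e‖ ≤ (16 * Real.pi)⁻¹) {x : ℝ}
    (hx : x ∈ Icc 0 (2 * Real.pi)) :
    ‖modelFun q (n + e) x - Complex.exp (-(Complex.I * n * x))‖ ≤
      4 * Real.pi * (1 + 2 * norm1 q) * ‖e‖ + 2 * ‖partialCoeff q n x‖ := by
  have hq := norm1_nonneg q
  have he' : ‖-e‖ ≤ (16 * Real.pi)⁻¹ := by rwa [norm_neg]
  have h1 := norm_exp_shift_sub_one_le he' hx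
  rw [norm_neg] at h1
  have hn : ‖Complex.exp (-(Complex.I * n * x))‖ = 1 := by
    rw [Complex.norm_exp]; simp
  have hI : ∫ t in (0 : ℝ)..x, Complex.exp (Complex.I * (n + e) * t) * q t =
      partialCoeff q n x + ∫ t in (0 : ℝ)..x,
        (Complex.exp (Complex.I * n * t) * (Complex.exp (Complex.I * e * t) - 1)) * q t := by
    rw [partialCoeff, ← intervalIntegral.integral_add (intervalIntegrable_mul q (by fun_prop) hx)
      (intervalIntegrable_mul q (by fun_prop) hx)]
    refine intervalIntegral.integral_congr fun t _ => ?_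
    have : Complex.exp (Complex.I * (n + e) * t) =
        Complex.exp (Complex.I * n * t) * Complex.exp (Complex.I * e * t) := by
      rw [← Complex.exp_add]; congr 1; ring
    simp only [this]
    ring
  have hIn : ‖∫ t in (0 : ℝ)..x, Complex.exp (Complex.I * (n + e) * t) * q t‖ ≤
      ‖partialCoeff q n x‖ + 4 * Real.pi * ‖e‖ * norm1 q := by
    rw [hI]
    refine (norm_add_le _ _).trans (add_le_add le_rfl (norm_integral_mul_le q hx fun t ht => ?_))
    rw [norm_mul, norm_exp_I_int, one_mul]
    exact norm_exp_shift_sub_one_le he ht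
  have h2 : ‖Complex.exp (Complex.I * -e * x)‖ ≤ 2 := by
    have h3 : 4 * Real.pi * ‖e‖ ≤ 1 := by
      calc 4 * Real.pi * ‖e‖ ≤ 4 * Real.pi * (16 * Real.pi)⁻¹ := by gcongr
        _ = 1 / 4 := by have := Real.pi_pos; field_simp; norm_num
        _ ≤ 1 := by norm_num
    calc ‖Complex.exp (Complex.I * -e * x)‖ = ‖(Complex.exp (Complex.I * -e * x) - 1) + 1‖ := by
          rw [sub_add_cancel]
      _ ≤ _ := norm_add_le _ _
      _ ≤ 1 + 1 := add_le_add (h1.trans h3) (by simp)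
      _ = 2 := by norm_num
  have hsplit : modelFun q (n + e) x - Complex.exp (-(Complex.I * n * x)) =
      Complex.exp (-(Complex.I * n * x)) * ((Complex.exp (Complex.I * -e * x) - 1) +
        Complex.exp (Complex.I * -e * x) *
          (Complex.I * ∫ t in (0 : ℝ)..x, Complex.exp (Complex.I * (n + e) * t) * q t)) := by
    have : Complex.exp (-(Complex.I * (n + e) * x)) =
        Complex.exp (-(Complex.I * n * x)) * Complex.exp (Complex.I * -e * x) := by
      rw [← Complex.exp_add]; congr 1; ring
    rw [modelFun, this]; ring
  rw [hsplit, norm_mul, hn, one_mul]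
  calc _ ≤ 4 * Real.pi * ‖e‖ + 2 * (‖partialCoeff q n x‖ + 4 * Real.pi * ‖e‖ * norm1 q) := by
        refine (norm_add_le _ _).trans (add_le_add h1 ?_)
        rw [norm_mul, norm_mul, Complex.norm_I, one_mul]
        gcongr
    _ = _ := by ring

/-- The model eigenfunction, normalized as the Fourier basis. -/
def modelH (q : H) (w : ℂ) : H :=
  toH (fun x => ((√(2 * Real.pi))⁻¹ : ℝ) * modelFun q w x)
    (continuousOn_const.mul (continuousOn_modelFun q w))

theorem coeFn_modelH (q : H) (w : ℂ) :
    modelH q w =ᵐ[mu] fun x => ((√(2 * Real.pi))⁻¹ : ℝ) * modelFun q w x :=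
  coeFn_toH (continuousOn_const.mul (continuousOn_modelFun q w))

theorem summable_modelH_sub (q : H) {ε : ℤ → ℂ}
    (hε : ∀ n, ‖ε n‖ ≤ ‖partialCoeff q n (2 * Real.pi)‖) (hε' : ∀ n, ‖ε n‖ ≤ (16 * Real.pi)⁻¹) :
    Summable fun n : ℤ => ‖modelH q (n + ε n) - expBasis n‖ ^ 2 := by
  set C := 4 * Real.pi * (1 + 2 * norm1 q) with hC
  have h1 : Summable fun n => 2 * C ^ 2 * ‖ε n‖ ^ 2 +
      8 * (2 * Real.pi)⁻¹ * ∫ x, ‖partialCoeff q n x‖ ^ 2 ∂mu := by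
    refine Summable.add (Summable.mul_left _ ?_)
      (Summable.mul_left _ (summable_integral_partialCoeff q))
    refine Summable.of_nonneg_of_le (fun n => by positivity) (fun n => ?_) (summable_norm_sq_coeff q)
    have := hε n
    gcongr
  refine Summable.of_nonneg_of_le (fun n => by positivity) (fun n => ?_) h1
  have hcd : ContinuousOn (fun x : ℝ => ((√(2 * Real.pi))⁻¹ : ℝ) * modelFun q (n + ε n) x - expFun n x)
      (Icc 0 (2 * Real.pi)) :=
    (continuousOn_const.mul (continuousOn_modelFun q _)).sub (continuous_expFun n).continuousOn
  have h2 : modelH q (n + ε n) - expBasis n = toH _ hcd := by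
    rw [expBasis_apply]; rfl
  have hi : Integrable (fun x => ‖partialCoeff q n x‖ ^ 2) mu := by
    have h1 := memLp_of_continuousOn (continuousOn_partialCoeff q n)
    exact (memLp_two_iff_integrable_sq_norm h1.1).1 h1
  rw [h2, norm_sq_toH]
  have hvol : ∫ _, (1 : ℝ) ∂mu = 2 * Real.pi := by
    simp [two_pi_pos.le]
  calc ∫ x, ‖((√(2 * Real.pi))⁻¹ : ℝ) * modelFun q (n + ε n) x - expFun n x‖ ^ 2 ∂mu
      ≤ ∫ x, ((2 * Real.pi)⁻¹ * (2 * C ^ 2 * ‖ε n‖ ^ 2) * 1 +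
          (8 * (2 * Real.pi)⁻¹) * ‖partialCoeff q n x‖ ^ 2) ∂mu := by
        refine integral_mono_of_nonneg (Eventually.of_forall fun x => by positivity)
          (((integrable_const _).const_mul _).add (hi.const_mul _)) ?_
        rw [EventuallyLE, ae_restrict_iff' measurableSet_Ioo]
        refine Eventually.of_forall fun x hx => ?_
        have h3 := norm_modelFun_sub_le q n (hε' n) (Ioo_subset_Icc_self hx)
        rw [expFun, ← mul_sub, norm_mul, mul_pow, Complex.norm_real,
          Real.norm_of_nonneg (inv_nonneg.2 (Real.sqrt_nonneg _)), inv_sqrt_two_pi_sq]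
        have h4 : ‖modelFun q (n + ε n) x - Complex.exp (-(Complex.I * n * x))‖ ^ 2 ≤
            2 * C ^ 2 * ‖ε n‖ ^ 2 + 8 * ‖partialCoeff q n x‖ ^ 2 := by
          have h5 : ‖modelFun q (n + ε n) x - Complex.exp (-(Complex.I * n * x))‖ ^ 2 ≤
            (C * ‖ε n‖ + 2 * ‖partialCoeff q n x‖) ^ 2 := by gcongr
          nlinarith [sq_nonneg (C * ‖ε n‖ - 2 * ‖partialCoeff q n x‖)]
        calc _ ≤ (2 * Real.pi)⁻¹ * (2 * C ^ 2 * ‖ε n‖ ^ 2 + 8 * ‖partialCoeff q n x‖ ^ 2) := by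
              gcongr
          _ = _ := by ring
    _ = _ := by
        rw [integral_add ((integrable_const _).const_mul _) (hi.const_mul _), integral_const_mul,
          integral_const_mul, hvol]
        have := two_pi_pos.ne'
        field_simp

end ModelEigenfunctions

/-! ### Removal of the potential by a gauge transformation -/

section Gauge

theorem exists_linfty {m : ℝ → ℂ} (hm : ContinuousOn m (Icc 0 (2 * Real.pi))) :
    ∃ M : LInfty, M =ᵐ[mu] m := by
  obtain ⟨C, hC⟩ := isCompact_Icc.exists_bound_of_continuousOn hm
  have : MemLp m ∞ mu := by
    refine MemLp.of_bound ((hm.mono Ioo_subset_Icc_self).aestronglyMeasurable measurableSet_Ioo) C ?_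
    rw [ae_restrict_iff' measurableSet_Ioo]
    exact Eventually.of_forall fun x hx => hC x (Ioo_subset_Icc_self hx)
  exact ⟨this.toLp _, this.coeFn_toLp⟩

/-- Multiplication by a continuous function without zeros is an isomorphism. -/
theorem exists_mulEquiv {m : ℝ → ℂ} (hm : ContinuousOn m (Icc 0 (2 * Real.pi)))
    (hm0 : ∀ x, m x ≠ 0) :
    ∃ S : H ≃L[ℂ] H, (∀ f, S f =ᵐ[mu] fun x => m x * f x) ∧
      ∀ f, S.symm f =ᵐ[mu] fun x => (m x)⁻¹ * f x := by
  obtain ⟨M, hM⟩ := exists_linfty hm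
  obtain ⟨M', hM'⟩ := exists_linfty (hm.inv₀ fun x _ => hm0 x)
  have h1 : ∀ f, mulOp M f =ᵐ[mu] fun x => m x * f x := fun f => by
    filter_upwards [coeFn_mulOp M f, hM] with x h1 h2
    rw [h1, h2]
  have h2 : ∀ f, mulOp M' f =ᵐ[mu] fun x => (m x)⁻¹ * f x := fun f => by
    filter_upwards [coeFn_mulOp M' f, hM'] with x h1 h2
    rw [h1, h2]; rfl
  refine ⟨ContinuousLinearEquiv.equivOfInverse ((mulOp M).mkContinuous ‖M‖ (norm_mulOp_le M))
    ((mulOp M').mkContinuous ‖M'‖ (norm_mulOp_le M')) (fun f => ?_) (fun f => ?_), h1, h2⟩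
  · refine Lp.ext ?_
    change mulOp M' (mulOp M f) =ᵐ[mu] f
    filter_upwards [h2 (mulOp M f), h1 f] with x h3 h4
    rw [h3, h4, inv_mul_cancel_left₀ (hm0 x)]
  · refine Lp.ext ?_
    change mulOp M (mulOp M' f) =ᵐ[mu] f
    filter_upwards [h1 (mulOp M' f), h2 f] with x h3 h4
    rw [h3, h4, mul_inv_cancel_left₀ (hm0 x)]

theorem integral_potential (V : LInfty) (z : ℂ) {x : ℝ} (hx : x ∈ Icc 0 (2 * Real.pi)) :
    ∫ t in (0 : ℝ)..x, Complex.I * (V t - z) =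
      Complex.I * (∫ t in (0 : ℝ)..x, V t) - Complex.I * z * x := by
  rw [intervalIntegral.integral_const_mul,
    intervalIntegral.integral_sub (intervalIntegrable_linfty V hx) intervalIntegrable_const,
    intervalIntegral.integral_const]
  simp; ring

/-- The operator `A` has eigenvalues `n + c + ε n` for all but finitely many `n`, with eigenvectors
quadratically close to a Riesz basis. -/
theorem exists_eigensystem (V : LInfty) {ρ : ℂ} (k : H) (hρ : ρ ≠ 0) {c : ℂ}
    (hc : Complex.exp (2 * Real.pi * Complex.I * c) =
      ρ * Complex.exp (Complex.I * ∫ t in (0 : ℝ)..(2 * Real.pi), V t)) :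
    ∃ (S : H ≃L[ℂ] H) (h : ℤ → H) (ε : ℤ → ℂ) (F : Finset ℤ),
      (Summable fun n => ‖h n - expBasis n‖ ^ 2) ∧ (∀ n, ‖ε n‖ ≤ (16 * Real.pi)⁻¹) ∧
      Tendsto (fun n => ‖ε n‖) cofinite (𝓝 0) ∧
      ∀ n ∉ F, S (h n) ≠ 0 ∧ ∃ hd : S (h n) ∈ (opA V ρ k).domain,
        opA V ρ k ⟨S (h n), hd⟩ = (n + c + ε n) • S (h n) := by
  have hr := right_mem_Icc.2 two_pi_pos.le
  -- The term with `c` normalizes the gauge so that `ρ m(2π) = 1`, which reduces the boundary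
  -- condition to the periodic one.
  let m : ℝ → ℂ := fun x => Complex.exp (Complex.I * (∫ t in (0 : ℝ)..x, V t) - Complex.I * c * x)
  have hm0 : ∀ x, m x ≠ 0 := fun x => Complex.exp_ne_zero _
  have hmc : ContinuousOn m (Icc 0 (2 * Real.pi)) := by
    have h1 := (absolutelyContinuous_integral (intervalIntegrable_linfty V hr)).continuousOn
    rw [uIcc_of_le two_pi_pos.le] at h1
    exact ((continuousOn_const.mul h1).sub (Continuous.continuousOn (by fun_prop))).cexp
  have hs0 : ((√(2 * Real.pi) : ℝ) : ℂ) ≠ 0 :=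
    Complex.ofReal_ne_zero.2 (Real.sqrt_ne_zero'.2 two_pi_pos)
  obtain ⟨Sm, -, hSm⟩ := exists_mulEquiv hmc hm0
  obtain ⟨S, hS, -⟩ := exists_mulEquiv (m := fun x => ((√(2 * Real.pi) : ℝ) : ℂ) * (ρ * m x))
    (continuousOn_const.mul (continuousOn_const.mul hmc))
    (fun x => mul_ne_zero hs0 (mul_ne_zero hρ (hm0 x)))
  let q : H := ρ⁻¹ • Sm.symm k
  have hq : q =ᵐ[mu] fun x => ρ⁻¹ * ((m x)⁻¹ * k x) := by
    filter_upwards [Lp.coeFn_smul ρ⁻¹ (Sm.symm k), hSm k] with x h1 h2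
    rw [h1, Pi.smul_apply, h2, smul_eq_mul]
  obtain ⟨F, ε, hε1, hε2, hε3⟩ := exists_shifts q
  have hlim : Tendsto (fun n => ‖ε n‖) cofinite (𝓝 0) :=
    squeeze_zero (fun n => norm_nonneg _) hε1 (tendsto_coeff q)
  have hfun : ∀ (w : ℂ), ∀ x ∈ Icc 0 (2 * Real.pi),
      eigFun V ρ k (c + w) x = ρ * m x * modelFun q w x := by
    intro w x hx
    have hE : ∀ t ∈ Icc 0 (2 * Real.pi), Complex.exp (∫ s in (0 : ℝ)..t, Complex.I * (V s - (c + w))) =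
        m t * Complex.exp (-(Complex.I * w * t)) := by
      intro t ht
      rw [integral_potential V _ ht, ← Complex.exp_add]
      congr 1; ring
    have hint : ∫ t in (0 : ℝ)..x, Complex.exp (-∫ s in (0 : ℝ)..t, Complex.I * (V s - (c + w))) *
        (Complex.I • k : H) t =
        ρ * (Complex.I * ∫ t in (0 : ℝ)..x, Complex.exp (Complex.I * w * t) * q t) := by
      rw [← intervalIntegral.integral_const_mul, ← intervalIntegral.integral_const_mul]
      refine integral_congr_coe ?_ hx
      filter_upwards [hq, Lp.coeFn_smul Complex.I k, ae_restrict_mem measurableSet_Ioo]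
        with t h1 h2 h3
      rw [h1, h2, Pi.smul_apply, smul_eq_mul, Complex.exp_neg, hE t (Ioo_subset_Icc_self h3),
        mul_inv, ← Complex.exp_neg (-(Complex.I * w * t)), neg_neg]
      field_simp
    rw [eigFun, solFun, hint, hE x hx, modelFun]
    ring
  have hSh : ∀ w, S (modelH q w) = toH _ (continuousOn_eigFun V ρ k (c + w)) := by
    intro w
    refine Lp.ext ?_
    filter_upwards [hS (modelH q w), coeFn_toH (continuousOn_eigFun V ρ k (c + w)),
      coeFn_modelH q w, ae_restrict_mem measurableSet_Ioo] with x h1 h2 h3 h4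
    rw [h1, h2, h3, hfun w x (Ioo_subset_Icc_self h4)]
    push_cast
    field_simp
  refine ⟨S, fun n => modelH q (n + ε n), ε, F, summable_modelH_sub q hε1 hε2, hε2, hlim,
    fun n hn => ?_⟩
  have h1 : eigFun V ρ k (c + (n + ε n)) (2 * Real.pi) = 1 := by
    have hm2 : ρ * m (2 * Real.pi) = 1 := by
      simp only [m]
      rw [Complex.exp_sub, ← mul_div_assoc, ← hc, ← Complex.exp_sub]
      rw [Complex.exp_eq_one_iff]
      exact ⟨0, by push_cast; ring⟩
    have h2 : ∫ t in (0 : ℝ)..(2 * Real.pi), Complex.exp (Complex.I * (n + ε n) * t) * q t =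
        ∫ t in (0 : ℝ)..(2 * Real.pi),
          Complex.exp (Complex.I * n * t) * Complex.exp (Complex.I * ε n * t) * q t := by
      refine intervalIntegral.integral_congr fun t _ => ?_
      simp only [← Complex.exp_add]
      congr 2; ring
    rw [hfun _ _ hr, hm2, one_mul, modelFun, h2, ← hε3 n hn, add_sub_cancel, ← Complex.exp_add,
      Complex.exp_eq_one_iff]
    exact ⟨-n, by push_cast; ring⟩
  simp only [hSh]
  obtain ⟨hd, hA⟩ := opA_eigFun h1
  refine ⟨toH_eigFun_ne_zero h1, hd, ?_⟩
  rw [hA]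
  congr 1; ring

end Gauge

/-! ### Spectrum of the operator with a non-local point interaction -/

section Final

theorem mem_spectrumOf_of_eigenvector {E : Type*} [NormedAddCommGroup E] [InnerProductSpace ℂ E]
    [CompleteSpace E] {A : E →ₗ.[ℂ] E} {z : ℂ} {f : E} (hf : f ≠ 0) (hd : f ∈ A.domain)
    (h : A ⟨f, hd⟩ = z • f) : z ∈ spectrumOf A := by
  refine mem_spectrumOf_of_rootSpace_ne_bot fun hb => hf ?_
  have h1 : f ∈ rootSpace A z := ⟨1, (mem_kerPow_succ A z 0 f).2 ⟨hd, by
    rw [h, sub_self]; exact Submodule.zero_mem _⟩⟩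
  rwa [hb, Submodule.mem_bot] at h1

theorem integral_im_pos {V : LInfty} (hV : ∀ᵐ x ∂mu, 0 ≤ (V x).im)
    (hpos : 0 < mu {x | 0 < (V x).im}) :
    0 < (∫ t in (0 : ℝ)..(2 * Real.pi), V t).im := by
  have hi : Integrable V mu := (Lp.memLp V).integrable le_top
  rw [intervalIntegral.integral_of_le two_pi_pos.le, integral_Ioc_eq_integral_Ioo,
    ← RCLike.im_eq_complex_im, ← integral_im hi]
  refine (integral_pos_iff_support_of_nonneg_ae hV hi.im).2 ?_
  refine hpos.trans_le (measure_mono fun x hx => ?_)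
  exact ne_of_gt hx

/-- `Im c = -log |r| / (2π)` for `r = ρ e^{i∫V}`, and `|r| < 1` because `|ρ| ≤ 1` and `∫ Im V > 0`.
-/
theorem exists_gauge_exponent {V : LInfty} {ρ : ℂ} (hρ : ρ ≠ 0) (hρ1 : ‖ρ‖ ≤ 1)
    (hV : ∀ᵐ x ∂mu, 0 ≤ (V x).im) (hpos : 0 < mu {x | 0 < (V x).im}) :
    ∃ c : ℂ, 0 < c.im ∧ Complex.exp (2 * Real.pi * Complex.I * c) =
      ρ * Complex.exp (Complex.I * ∫ t in (0 : ℝ)..(2 * Real.pi), V t) := by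
  set r := ρ * Complex.exp (Complex.I * ∫ t in (0 : ℝ)..(2 * Real.pi), V t) with hr
  have hr0 : r ≠ 0 := mul_ne_zero hρ (Complex.exp_ne_zero _)
  have hrn : ‖r‖ < 1 := by
    rw [hr, norm_mul, Complex.norm_exp, Complex.I_mul_re]
    have h1 := integral_im_pos hV hpos
    have h2 : Real.exp (-(∫ t in (0 : ℝ)..(2 * Real.pi), V t).im) < 1 := by
      rw [Real.exp_lt_one_iff]; linarith
    nlinarith [norm_nonneg ρ, Real.exp_pos (-(∫ t in (0 : ℝ)..(2 * Real.pi), V t).im)]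
  refine ⟨Complex.log r / (2 * Real.pi * Complex.I), ?_, ?_⟩
  · have h1 : Complex.log r / (2 * Real.pi * Complex.I) =
        -(Complex.I * Complex.log r) * (((2 * Real.pi)⁻¹ : ℝ) : ℂ) := by
      have hpi : (Real.pi : ℂ) ≠ 0 := Complex.ofReal_ne_zero.2 Real.pi_ne_zero
      push_cast
      field_simp
      rw [Complex.I_sq]; ring
    rw [h1, Complex.im_mul_ofReal, Complex.neg_im, Complex.I_mul_im, Complex.log_re]
    have h2 := Real.log_neg (norm_pos_iff.2 hr0) hrn
    have := two_pi_pos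
    exact mul_pos (by linarith) (inv_pos.2 this)
  · rw [mul_div_cancel₀ _ Complex.two_pi_I_ne_zero, Complex.exp_log hr0]

theorem tendsto_norm_perturbed_int {c : ℂ} {ε : ℤ → ℂ} {C : ℝ} (hε : ∀ n, ‖ε n‖ ≤ C) :
    Tendsto (fun n : ℤ => ‖(n : ℂ) + c + ε n‖) cofinite atTop := by
  have h1 : Tendsto (fun n : ℤ => ‖n‖) cofinite atTop := by
    rw [← cocompact_eq_cofinite]; exact tendsto_norm_cocompact_atTop
  refine tendsto_atTop_mono (fun n => ?_) (tendsto_atTop_add_const_right _ (-(‖c‖ + C)) h1)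
  have h2 : (n : ℂ) = ((n : ℂ) + c + ε n) - (c + ε n) := by ring
  have h3 : ‖(n : ℂ)‖ ≤ ‖(n : ℂ) + c + ε n‖ + ‖c + ε n‖ := by
    conv_lhs => rw [h2]
    exact norm_sub_le _ _
  have h4 := norm_add_le c (ε n)
  have h5 : ‖(n : ℂ)‖ = ‖n‖ := by simp [Int.norm_eq_abs]
  have := hε n
  linarith

theorem injective_perturbed_int {c : ℂ} {ε : ℤ → ℂ} (hε : ∀ n, ‖ε n‖ ≤ (16 * Real.pi)⁻¹) :
    Function.Injective fun n : ℤ => (n : ℂ) + c + ε n := by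
  intro n m hnm
  have h1 : ((n - m : ℤ) : ℂ) = ε m - ε n := by
    have : (n : ℂ) + c + ε n = m + c + ε m := hnm
    push_cast
    linear_combination this
  have h2 : ‖((n - m : ℤ) : ℂ)‖ < 1 := by
    rw [h1]
    have h3 : (16 * Real.pi)⁻¹ < 1 / 2 := by
      rw [one_div]
      exact inv_strictAnti₀ two_pos (by linarith [Real.pi_gt_three])
    linarith [norm_sub_le (ε m) (ε n), hε n, hε m]
  rw [Complex.norm_intCast] at h2
  have h3 : |n - m| < 1 := by exact_mod_cast h2
  exact sub_eq_zero.1 (Int.abs_lt_one_iff.1 h3)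

end Final

end NonlocalPoint

end

/-! ### The main theorem -/

open NonlocalPoint in
theorem corollary4p5 (V : LInfty) (ρ : ℂ) (k : H)
    (hV_nonneg : ∀ᵐ x ∂mu, 0 ≤ (V x).im)
    (hV_pos : 0 < mu {x | 0 < (V x).im})
    (hρ : ρ ≠ 0)
    (hA : IsMaxDissipative (opA V ρ k)) :
    (∃ ζ : ℝ, 0 < ζ ∧
      IsGLB (Complex.im '' (spectrumOf (opA V ρ k) \ Set.range Complex.ofReal)) ζ) ∧
    (∃ f : ℤ → H, IsRootSystem (opA V ρ k) f ∧ ∀ n, ‖f n‖ = 1) ∧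
    (∀ f : ℤ → H, IsRootSystem (opA V ρ k) f →
      (∃ c C : ℝ, 0 < c ∧ ∀ n, c ≤ ‖f n‖ ∧ ‖f n‖ ≤ C) → IsRieszBasis f) := by
  have hdis := hA.1
  obtain ⟨c, hc0, hc⟩ := exists_gauge_exponent hρ (norm_boundary_le_one hdis) hV_nonneg hV_pos
  obtain ⟨S, h, ε, F₀, hsum, hε, hlim, heig⟩ := exists_eigensystem V k hρ hc
  obtain ⟨R, hR⟩ := mem_resolventSetOf_opA hdis (z := -Complex.I) (by simp)
  obtain ⟨F, T, q, hF, hsplit⟩ := exists_tailSplit_of_summable hdis.1 hR expBasis S hsum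
    (F₀ := F₀) (lam := fun n => (n : ℂ) + c + ε n) (injective_perturbed_int hε).injOn
    (tendsto_norm_perturbed_int hε) (fun n hn => (heig n hn).2)
  refine ⟨?_, hsplit.exists_isRootSystem hR,
    fun f hf ⟨a, C, ha, hb⟩ => hsplit.isRieszBasis_of_isRootSystem hR hf ha hb⟩
  set X := Complex.im '' (spectrumOf (opA V ρ k) \ Set.range Complex.ofReal) with hX
  have him : ∀ n : ℤ, c.im - ‖ε n‖ ≤ ((n : ℂ) + c + ε n).im := by
    intro n
    have := (abs_le.1 (Complex.abs_im_le_norm (ε n))).1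
    simp only [Complex.add_im, Complex.intCast_im]
    linarith
  have hne : X.Nonempty := by
    obtain ⟨n, hn1, hn2⟩ := ((hlim.eventually_lt_const hc0).and
      (F₀.finite_toSet.eventually_cofinite_notMem)).exists
    obtain ⟨h0, hd, he⟩ := heig n hn2
    refine ⟨_, _, ⟨mem_spectrumOf_of_eigenvector h0 hd he, ?_⟩, rfl⟩
    rintro ⟨t, ht⟩
    have h1 := him n
    rw [← ht, Complex.ofReal_im] at h1
    linarith
  have hpos : ∀ y ∈ X, 0 < y := by
    rintro _ ⟨z, ⟨hz, hz'⟩, rfl⟩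
    refine lt_of_le_of_ne (not_lt.1 fun hlt => hz (mem_resolventSetOf_opA hdis hlt)) fun h0 => hz' ?_
    exact ⟨z.re, Complex.ext rfl (by simpa using h0)⟩
  -- Below height `Im c / 2` lie only the finitely many exceptional spectral points and those `n + c
  -- + ε n` with `‖ε n‖ ≥ Im c / 2`, again finitely many.
  have hfin : (X ∩ Set.Iio (c.im / 2)).Finite := by
    have h1 : {n : ℤ | ¬ ‖ε n‖ < c.im / 2}.Finite := hlim.eventually_lt_const (half_pos hc0)
    refine (((hsplit.finite_spectrum hR).union (h1.image fun n : ℤ => (n : ℂ) + c + ε n)).image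
      Complex.im).subset ?_
    rintro _ ⟨⟨z, ⟨hz, -⟩, rfl⟩, hlt⟩
    refine ⟨z, ?_, rfl⟩
    by_cases hz' : ∀ n ∉ F, (n : ℂ) + c + ε n ≠ z
    · exact Or.inl ⟨hz, hz'⟩
    · push Not at hz'
      obtain ⟨n, -, rfl⟩ := hz'
      refine Or.inr ⟨n, fun hn => ?_, rfl⟩
      have := him n
      have h2 : ((n : ℂ) + c + ε n).im < c.im / 2 := hlt
      linarith
  obtain ⟨η, hη0, hη⟩ : ∃ η : ℝ, 0 < η ∧ ∀ y ∈ X, η ≤ y := by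
    rcases (X ∩ Set.Iio (c.im / 2)).eq_empty_or_nonempty with hemp | hnon
    · refine ⟨c.im / 2, half_pos hc0, fun y hy => not_lt.1 fun hlt => ?_⟩
      exact (hemp ▸ (⟨hy, hlt⟩ : y ∈ X ∩ Set.Iio (c.im / 2)) : y ∈ (∅ : Set ℝ))
    · obtain ⟨y₀, hy₀, hmin⟩ := Set.exists_min_image _ id hfin hnon
      refine ⟨y₀, hpos y₀ hy₀.1, fun y hy => ?_⟩
      by_cases hlt : y < c.im / 2
      · exact hmin y ⟨hy, hlt⟩
      · exact hy₀.2.le.trans (not_lt.1 hlt)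
  exact ⟨sInf X, hη0.trans_le (le_csInf hne hη), isGLB_csInf hne ⟨η, hη⟩⟩
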